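/- Let $n\ge 1$ and let $G=\mathrm{Sp}_{2n}(\mathbb C)$ be the simply connected simple algebraic group of type $C_n$, realized on the vector representation $V(\Lambda_1)$ with basis $v_1,\dots,v_n,v_{\bar n},\dots,v_{\bar 1}$ and Chevalley generators given by $f_iv_i=v_{i+1}$, $f_iv_{\overline{i+1}}=v_{\bar i}$, $e_iv_{i+1}=v_i$, $e_iv_{\bar i}=v_{\overline{i+1}}$ $(1\le i<n)$, $f_nv_n=v_{\bar n}$, $e_nv_{\bar n}=v_n$, all other actions on basis vectors being zero. Let $T$ be the diagonal maximal torus, $U^{\pm}$ the upper and lower unitriangular subgroups of $G$ (in the above order of the basis), $\Lambda_1,\dots,\Lambda_n$ the fundamental weights, so that $v_j$ has weight $\Lambda_j-\Lambda_{j-1}$ and $v_{\bar j}$ has weight $\Lambda_{j-1}-\Lambda_j$ with $\Lambda_0=0$, and $\alpha_i^\vee:\mathbb C^\times\to T$ the simple coroots. Put $x_i(t)=\exp(te_i)$, $y_i(t)=\exp(tf_i)$, $\bar s_i=x_i(-1)y_i(1)x_i(-1)$, and $\bar w=\bar s_{i_1}\cdots\bar s_{i_l}$ for a reduced word $(i_1,\dots,i_l)$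 of a Weyl group element $w$. The principal minor $\Delta_{\Lambda_k}$ is the regular function on $G$ with $\Delta_{\Lambda_k}(u^-tu^+)=\Lambda_k(t)$ for $u^\pm\in U^\pm$, $t\in T$, and the generalized minors are $\Delta_{u\Lambda_k,v\Lambda_k}(g)=\Delta_{\Lambda_k}(\bar u^{-1}g\,\bar v)$. Let $w_0$ be the longest Weyl group element, with the reduced word $\mathbf i_0=(1\,2\cdots n)^n$. For $c=(c^{(1)}_1,c^{(1)}_2,\dots,c^{(1)}_n,c^{(2)}_1,\dots,c^{(n)}_n)\in(\mathbb C^\times)^{n^2}$ set $$\Theta^-_{\mathbf i_0}(c)=\prod_{j=1}^{n}\Big(\mathbf y_1(c^{(j)}_1)\,\mathbf y_2(c^{(j)}_2)\cdots\mathbf y_n(c^{(j)}_n)\Big),\qquad \mathbf y_i(a)=y_i(a)\,\alpha_i^\vee(a^{-1}),$$ the factors of the outer product being taken in the order $j=1,2,\dots,n$ from left to right. Then for $k=1,\dots,n-1$ $$\Delta_{w_0\Lambda_k,s_k\Lambda_k}(\Theta^-_{\mathbf i_0}(c))=c^{(k)}_1+\sum_{j=2}^{n}\frac{c^{(k)}_j}{c^{(k+1)}_{j-1}}+\sum_{j=1}^{n-k}\frac{c^{(k+j)}_{n-j}}{c^{(k+j)}_{n-j+1}},$$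 and for $k=n$ $$\Delta_{w_0\Lambda_n,s_n\Lambda_n}(\Theta^-_{\mathbf i_0}(c))=c^{(n)}_n.$$ -/

import Mathlib

namespace TypeC

open Matrix

/-- The index set of the basis of the vector representation `V(Λ₁)` of type `C_n`:
`Sum.inl a` is the index of `v_{a+1}` and `Sum.inr a` that of `v_{\overline{a+1}}`. -/
abbrev Idx (n : ℕ) : Type := Fin n ⊕ Fin n

/-- The Chevalley generator `e_i` (`1 ≤ i ≤ n`) on `V(Λ₁)`:
for `i < n`, `e_i v_{i+1} = v_i` and `e_i v_{\bar i} = v_{\overline{i+1}}`;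
`e_n v_{\bar n} = v_n`; all other basis vectors are sent to `0`. -/
def e (n i : ℕ) : Matrix (Idx n) (Idx n) ℂ :=
  Matrix.fromBlocks
    (Matrix.of fun a b => if a.val + 1 = i ∧ b.val + 1 = i + 1 then 1 else 0)
    (Matrix.of fun a b => if a.val + 1 = i ∧ b.val + 1 = i ∧ i = n then 1 else 0)
    0
    (Matrix.of fun a b => if a.val + 1 = i + 1 ∧ b.val + 1 = i then 1 else 0)

/-- The Chevalley generator `f_i` (`1 ≤ i ≤ n`) on `V(Λ₁)`:
for `i < n`, `f_i v_i = v_{i+1}` and `f_i v_{\overline{i+1}} = v_{\bar i}`;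
`f_n v_n = v_{\bar n}`; all other basis vectors are sent to `0`. -/
def f (n i : ℕ) : Matrix (Idx n) (Idx n) ℂ :=
  Matrix.fromBlocks
    (Matrix.of fun a b => if a.val + 1 = i + 1 ∧ b.val + 1 = i then 1 else 0)
    0
    (Matrix.of fun a b => if a.val + 1 = i ∧ b.val + 1 = i ∧ i = n then 1 else 0)
    (Matrix.of fun a b => if a.val + 1 = i ∧ b.val + 1 = i + 1 then 1 else 0)

/-- The eigenvalue of the simple coroot `h_i` on a basis vector of `V(Λ₁)`, that is,
`⟨h_i, wt v_j⟩` with `wt v_j = Λ_j - Λ_{j-1}` and `wt v_{\bar j} = Λ_{j-1} - Λ_j`. -/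
def hWeight (n i : ℕ) : Idx n → ℤ
  | Sum.inl a => (if a.val + 1 = i then 1 else 0) - (if a.val = i then 1 else 0)
  | Sum.inr a => (if a.val = i then 1 else 0) - (if a.val + 1 = i then 1 else 0)

/-- The signs `⟨v_j, v_{\bar j}⟩ = (-1)^j` of the invariant symplectic form. -/
def formSign (n : ℕ) : Matrix (Fin n) (Fin n) ℂ :=
  Matrix.diagonal fun a => (-1) ^ (a.val + 1)

/-- The Gram matrix of the non-degenerate alternating form on `V(Λ₁)` that is invariant under
all `e_i` and `f_i`: `⟨v_j, v_{\bar j}⟩ = (-1)^j = -⟨v_{\bar j}, v_j⟩`, all others `0`. -/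
def form (n : ℕ) : Matrix (Idx n) (Idx n) ℂ :=
  Matrix.fromBlocks 0 (formSign n) (-formSign n) 0

/-- The simply connected group `G = Sp_{2n}(ℂ)` of type `C_n`, acting on `V(Λ₁)`. -/
def G (n : ℕ) : Subgroup (GL (Idx n) ℂ) where
  carrier := {g | (g.val)ᵀ * form n * g.val = form n}
  one_mem' := by simp
  mul_mem' := by
    intro a b ha hb
    simp only [Set.mem_ofPred_eq, Units.val_mul, Matrix.transpose_mul] at *
    calc (b.val)ᵀ * (a.val)ᵀ * form n * (a.val * b.val)
        = (b.val)ᵀ * ((a.val)ᵀ * form n * a.val) * b.val := by simp only [Matrix.mul_assoc]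
      _ = form n := by rw [ha, hb]
  inv_mem' := by
    intro a ha
    simp only [Set.mem_ofPred_eq] at *
    have h1 : a.val * (a⁻¹).val = 1 := a.mul_inv
    have h2 : ((a⁻¹).val)ᵀ * (a.val)ᵀ = 1 := by
      rw [← Matrix.transpose_mul, h1, Matrix.transpose_one]
    calc ((a⁻¹).val)ᵀ * form n * (a⁻¹).val
        = ((a⁻¹).val)ᵀ * ((a.val)ᵀ * form n * a.val) * (a⁻¹).val := by rw [ha]
      _ = (((a⁻¹).val)ᵀ * (a.val)ᵀ) * form n * (a.val * (a⁻¹).val) := by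
          simp only [Matrix.mul_assoc]
      _ = form n := by rw [h1, h2]; simp

/-- The matrix of an element of `G`. -/
def mat {n : ℕ} (g : G n) : Matrix (Idx n) (Idx n) ℂ := g.val.val

theorem e_sq (n i : ℕ) : e n i * e n i = 0 := by
  ext a b
  rw [Matrix.mul_apply, Matrix.zero_apply]
  refine Finset.sum_eq_zero fun x _ => ?_
  rcases a with a | a <;> rcases b with b | b <;> rcases x with x | x <;>
    simp [e, Matrix.of_apply] <;> omega

theorem f_eq (n i : ℕ) : f n i = (e n i)ᵀ := by
  ext a b
  rcases a with a | a <;> rcases b with b | b <;> simp only [e, f, Matrix.transpose_apply,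
    Matrix.fromBlocks_apply₁₁, Matrix.fromBlocks_apply₁₂, Matrix.fromBlocks_apply₂₁,
    Matrix.fromBlocks_apply₂₂, Matrix.of_apply, Matrix.zero_apply]
  all_goals exact if_congr (by omega) rfl rfl

theorem f_sq (n i : ℕ) : f n i * f n i = 0 := by
  rw [f_eq, ← Matrix.transpose_mul, e_sq, Matrix.transpose_zero]

theorem exp_smul_eq {n : ℕ} {N : Matrix (Idx n) (Idx n) ℂ} (hN : N * N = 0) (t : ℂ) :
    IsNilpotent.exp (t • N) = 1 + t • N := by
  have h : (t • N) ^ 2 = 0 := by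
    rw [pow_two, Matrix.smul_mul, Matrix.mul_smul, hN]; simp
  rw [IsNilpotent.exp_eq_sum h]
  simp [Finset.sum_range_succ]

theorem e_form (n i : ℕ) : (e n i)ᵀ * form n = -(form n * e n i) := by
  ext a b
  rcases a with a | a <;> rcases b with b | b <;>
    simp only [e, form, formSign, Matrix.fromBlocks_multiply, Matrix.fromBlocks_transpose,
      Matrix.mul_diagonal, Matrix.diagonal_mul, Matrix.neg_apply, Matrix.fromBlocks_apply₁₁,
      Matrix.fromBlocks_apply₁₂, Matrix.fromBlocks_apply₂₁, Matrix.fromBlocks_apply₂₂,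
      Matrix.add_apply, Matrix.mul_zero, Matrix.zero_mul, Matrix.zero_apply, Matrix.mul_neg,
      Matrix.neg_mul, Matrix.transpose_apply, Matrix.of_apply, Matrix.transpose_zero]
  all_goals first
    | simp; done
    | split_ifs <;> first
        | omega
        | simp; done
        | (rw [show b.val = a.val by omega]; ring)
        | (rw [show b.val = a.val + 1 by omega]; ring)
        | (rw [show a.val = b.val + 1 by omega]; ring)

theorem f_form (n i : ℕ) : (f n i)ᵀ * form n = -(form n * f n i) := by
  ext a b
  rcases a with a | a <;> rcases b with b | b <;>
    simp only [f, form, formSign, Matrix.fromBlocks_multiply, Matrix.fromBlocks_transpose,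
      Matrix.mul_diagonal, Matrix.diagonal_mul, Matrix.neg_apply, Matrix.fromBlocks_apply₁₁,
      Matrix.fromBlocks_apply₁₂, Matrix.fromBlocks_apply₂₁, Matrix.fromBlocks_apply₂₂,
      Matrix.add_apply, Matrix.mul_zero, Matrix.zero_mul, Matrix.zero_apply, Matrix.mul_neg,
      Matrix.neg_mul, Matrix.transpose_apply, Matrix.of_apply, Matrix.transpose_zero]
  all_goals first
    | simp; done
    | split_ifs <;> first
        | omega
        | simp; done
        | (rw [show b.val = a.val by omega]; ring)
        | (rw [show b.val = a.val + 1 by omega]; ring)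
        | (rw [show a.val = b.val + 1 by omega]; ring)

/-- `exp(tN)` is symplectic if `N² = 0` and `N` is infinitesimally symplectic. -/
theorem exp_mem {n : ℕ} {N : Matrix (Idx n) (Idx n) ℂ} (hN : N * N = 0)
    (hf : Nᵀ * form n = -(form n * N)) (t : ℂ) :
    (IsNilpotent.exp (t • N))ᵀ * form n * IsNilpotent.exp (t • N) = form n := by
  rw [exp_smul_eq hN]
  have h : Nᵀ * form n * N = 0 := by
    rw [hf, Matrix.neg_mul, Matrix.mul_assoc, hN]; simp
  simp only [Matrix.transpose_add, Matrix.transpose_one, Matrix.transpose_smul, Matrix.add_mul,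
    Matrix.mul_add, Matrix.one_mul, Matrix.mul_one, Matrix.smul_mul, Matrix.mul_smul, h]
  rw [hf]
  simp

theorem isNilpotent_smul {n : ℕ} {N : Matrix (Idx n) (Idx n) ℂ} (hN : N * N = 0) (t : ℂ) :
    IsNilpotent (t • N) :=
  ⟨2, by rw [pow_two, Matrix.smul_mul, Matrix.mul_smul, hN]; simp⟩

/-- The one-parameter subgroup `exp(tN)` of `G`. -/
noncomputable def oneParam {n : ℕ} (N : Matrix (Idx n) (Idx n) ℂ) (hN : N * N = 0)
    (hf : Nᵀ * form n = -(form n * N)) (t : ℂ) : G n :=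
  ⟨⟨IsNilpotent.exp (t • N), IsNilpotent.exp (-(t • N)),
    IsNilpotent.exp_mul_exp_neg_self (isNilpotent_smul hN t),
    IsNilpotent.exp_neg_mul_exp_self (isNilpotent_smul hN t)⟩, exp_mem hN hf t⟩

/-- `x_i(t) = exp(t e_i)`. -/
noncomputable def x (n i : ℕ) (t : ℂ) : G n := oneParam (e n i) (e_sq n i) (e_form n i) t

/-- `y_i(t) = exp(t f_i)`. -/
noncomputable def y (n i : ℕ) (t : ℂ) : G n := oneParam (f n i) (f_sq n i) (f_form n i) t

/-- `α_i^∨(c) = c^{h_i}`, the image of `diag(c, c⁻¹)` under the homomorphism `SL₂ → G`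
attached to `i`. -/
noncomputable def coroot (n i : ℕ) (c : ℂˣ) : G n :=
  ⟨⟨Matrix.diagonal fun a => ((c ^ hWeight n i a : ℂˣ) : ℂ),
    Matrix.diagonal fun a => ((c ^ (-hWeight n i a) : ℂˣ) : ℂ),
    by rw [Matrix.diagonal_mul_diagonal, ← Matrix.diagonal_one]
       congr 1; funext a; rw [← Units.val_mul, ← _root_.zpow_add]; simp,
    by rw [Matrix.diagonal_mul_diagonal, ← Matrix.diagonal_one]
       congr 1; funext a; rw [← Units.val_mul, ← _root_.zpow_add]; simp⟩, by
    change (Matrix.diagonal _)ᵀ * form n * Matrix.diagonal _ = form n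
    ext a b
    rw [Matrix.diagonal_transpose, Matrix.mul_diagonal, Matrix.diagonal_mul]
    by_cases h : hWeight n i a + hWeight n i b = 0
    · have h' : ((c ^ hWeight n i a : ℂˣ) : ℂ) * ((c ^ hWeight n i b : ℂˣ) : ℂ) = 1 := by
        rw [← Units.val_mul, ← _root_.zpow_add, h]; simp
      calc _ = form n a b * (((c ^ hWeight n i a : ℂˣ) : ℂ) * ((c ^ hWeight n i b : ℂˣ) : ℂ)) := by
              ring
        _ = _ := by rw [h', mul_one]
    · have h' : form n a b = 0 := by
        rcases a with a | a <;> rcases b with b | b <;> simp [form, formSign]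
        all_goals
          by_contra hab
          have hab : a = b := by
            by_contra h2
            exact hab (Matrix.diagonal_apply_ne _ h2)
          subst hab
          exact h (by simp [hWeight])
      rw [h']; simp⟩

/-- `\bar s_i = x_i(-1) y_i(1) x_i(-1)`, the representative in `G` of the simple reflection. -/
noncomputable def sBar (n i : ℕ) : G n := x n i (-1) * y n i 1 * x n i (-1)

/-- The representative `\bar w = \bar s_{i_1} ⋯ \bar s_{i_l}` in `G` of the Weyl group element
`w = s_{i_1} ⋯ s_{i_l}` given by a reduced word `i_1, …, i_l`. -/
noncomputable def wBar (n : ℕ) (w : List ℕ) : G n := (w.map (sBar n)).prod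

/-- The reduced word `i₀ = (1 2 ⋯ n)^n` of the longest Weyl group element `w₀` of type `C_n`. -/
def longWord (n : ℕ) : List ℕ := (List.replicate n (List.range' 1 n)).flatten

/-- `𝐲_i(c) = y_i(c) α_i^∨(c⁻¹)`. -/
noncomputable def yBold (n i : ℕ) (c : ℂˣ) : G n := y n i c * coroot n i c⁻¹

/-- `Θ^-_{𝐢}(c_1, …, c_N) = 𝐲_{i_1}(c_1) ⋯ 𝐲_{i_N}(c_N)` for a word `𝐢 = (i_1, …, i_N)`. -/
noncomputable def Theta (n : ℕ) (w : List ℕ) (c : List ℂˣ) : G n :=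
  (List.zipWith (yBold n) w c).prod

/-- The array `c_i^{(j)}`, `1 ≤ i, j ≤ n` (written `c i j`), as the list
`(c_1^{(1)}, c_2^{(1)}, …, c_n^{(1)}, c_1^{(2)}, …, c_n^{(n)})`. -/
def params (n : ℕ) (c : ℕ → ℕ → ℂˣ) : List ℂˣ :=
  (List.range' 1 n).flatMap fun j => (List.range' 1 n).map fun i => c i j

/-- The position of a basis vector in the order
`v_1, v_2, …, v_n, v_{\bar n}, …, v_{\bar 2}, v_{\bar 1}`. -/
def pos (n : ℕ) : Idx n → ℕ
  | Sum.inl a => a.val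
  | Sum.inr a => 2 * n - 1 - a.val

/-- The maximal unipotent subgroup `U = U⁺`: the upper unitriangular elements of `G`
with respect to the order of the basis given by `pos`. -/
def IsUPlus {n : ℕ} (g : G n) : Prop :=
  (∀ a, mat g a a = 1) ∧ ∀ a b, pos n b < pos n a → mat g a b = 0

/-- The opposite maximal unipotent subgroup `U⁻`: the lower unitriangular elements of `G`. -/
def IsUMinus {n : ℕ} (g : G n) : Prop :=
  (∀ a, mat g a a = 1) ∧ ∀ a b, pos n a < pos n b → mat g a b = 0

/-- The maximal torus `T`: the diagonal elements of `G`. -/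
def IsTorus {n : ℕ} (g : G n) : Prop := (mat g).IsDiag

/-- The value at `t ∈ T` of the fundamental weight `Λ_k = wt v_1 + ⋯ + wt v_k`. -/
def fundWeight (n k : ℕ) (t : G n) : ℂ :=
  ∏ a : {a : Fin n // a.val + 1 ≤ k}, mat t (Sum.inl a.val) (Sum.inl a.val)

/-- Regular functions on the closed subgroup `G` of `SL_{2n}(ℂ)`: the restrictions of
polynomials in the matrix entries. -/
def IsRegular {n : ℕ} (F : G n → ℂ) : Prop :=
  ∃ P : MvPolynomial (Idx n × Idx n) ℂ, ∀ g : G n,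
    F g = MvPolynomial.eval (fun ab => mat g ab.1 ab.2) P

/-- `F` is the principal minor `Δ_μ` of the dominant weight `μ`: the regular function on `G`
with `Δ_μ(u⁻ t u⁺) = μ(t)` for `u^± ∈ U^±` and `t ∈ T`. -/
def IsPrincipalMinor {n : ℕ} (μ : G n → ℂ) (F : G n → ℂ) : Prop :=
  IsRegular F ∧ ∀ u t v : G n, IsUMinus u → IsTorus t → IsUPlus v → F (u * t * v) = μ t

theorem exists_principalMinor (n k : ℕ) :
    ∃ F : G n → ℂ, IsPrincipalMinor (fundWeight n k) F := by
  let r : {a : Fin n // a.val + 1 ≤ k} → Idx n := fun a => Sum.inl a.val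
  have hr : Function.Injective r := fun a b h => Subtype.ext (Sum.inl_injective h)
  have hout : ∀ (a : {a : Fin n // a.val + 1 ≤ k}) (b : Idx n), b ∉ Set.range r →
      pos n (r a) < pos n b := by
    rintro ⟨a, ha⟩ (b | b) hb
    · have hb' : ¬ b.val + 1 ≤ k := fun h => hb ⟨⟨b, h⟩, rfl⟩
      simp only [r, pos]; omega
    · simp only [r, pos]; omega
  refine ⟨fun g => ((mat g).submatrix r r).det,
    ⟨(Matrix.of fun a b => MvPolynomial.X (r a, r b)).det, fun g => ?_⟩, ?_⟩
  · rw [RingHom.map_det]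
    refine congrArg Matrix.det ?_
    ext a b
    simp
  · intro u t v hu ht hv
    have h1 : (mat (u * t * v)).submatrix r r =
        (mat u).submatrix r r * (mat t).submatrix r r * (mat v).submatrix r r := by
      change (mat u * mat t * mat v).submatrix r r = _
      ext a b
      rw [Matrix.mul_assoc, Matrix.mul_assoc, Matrix.submatrix_apply, Matrix.mul_apply,
        Matrix.mul_apply]
      symm
      refine Fintype.sum_of_injective r hr _ _ (fun x hx => ?_) (fun x => ?_)
      · rw [hu.2 _ _ (hout a x hx), zero_mul]
      · rw [Matrix.submatrix_apply, Matrix.mul_apply, Matrix.mul_apply]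
        congr 1
        refine Fintype.sum_of_injective r hr _ _ (fun z hz => ?_) (fun z => rfl)
        rw [hv.2 _ _ (hout b z hz), mul_zero]
    have hmono : ∀ a b : {a : Fin n // a.val + 1 ≤ k}, a < b → pos n (r a) < pos n (r b) :=
      fun a b h => h
    change ((mat (u * t * v)).submatrix r r).det = _
    have du : ((mat u).submatrix r r).det = 1 := by
      rw [← Matrix.det_transpose, Matrix.det_of_isUpperTriangular
        (M := ((mat u).submatrix r r)ᵀ) (fun a b h => hu.2 _ _ (hmono _ _ h))]
      simp [hu.1]
    have dv : ((mat v).submatrix r r).det = 1 := by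
      rw [Matrix.det_of_isUpperTriangular (M := (mat v).submatrix r r)
        (fun a b h => hv.2 _ _ (hmono _ _ h))]
      simp [hv.1]
    have dt : ((mat t).submatrix r r).det = fundWeight n k t := by
      rw [Matrix.det_of_isUpperTriangular (M := (mat t).submatrix r r)
        (fun a b h => ht (fun hab => absurd (hr hab) (ne_of_gt h)))]
      rfl
    rw [h1, Matrix.det_mul, Matrix.det_mul, du, dv, dt]
    simp

/-- The principal minor `Δ_{Λ_k}` of the fundamental weight `Λ_k`. (It is unique, because
`U⁻ T U⁺` is dense in `G`.) -/
noncomputable def principalMinor (n k : ℕ) : G n → ℂ := (exists_principalMinor n k).choose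

/-- The generalized minor `Δ_{uΛ_k, vΛ_k}(g) = Δ_{Λ_k}(\bar u⁻¹ g \bar v)`, where the Weyl group
elements `u` and `v` are given by reduced words. -/
noncomputable def genMinor (n k : ℕ) (u v : List ℕ) (g : G n) : ℂ :=
  principalMinor n k ((wBar n u)⁻¹ * g * wBar n v)

end TypeC

/-!
For `b` in the big cell `U⁻ T U⁺`, the product of `b` and `y_i(s)` stays in the big cell except for
at most one value of `s`, so by continuity two principal minors of the same weight agree on the
subgroup generated by all `x_i(s)` and `y_i(s)`; in particular the principal minor of weight `Λ_k`
is there the leading `k × k` minor. Left multiplication by `\bar w₀⁻¹` replaces the `i`-th row,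
counted from `0`, by `±` the row of `v_{\overline{i+1}}`, whose covector `coordBar n i` we call
`ξ i`. For a single block `Y = 𝐲_1(d_1) ⋯ 𝐲_n(d_n)` with `d_0 = 1` one computes
`ξ (i + 1) ᵥ* Y = (d_i / d_{i+1}) • (ξ i ᵥ* Y) - ξ i`, hence row operations turn the `i`-th row into
`ξ 0` times the product of all but the first `i` blocks. This product has the form
`coord n i + S • coord n (i + 1) + ⋯`: the matrix of the minor becomes upper triangular with
diagonal entries `1`, except that `\bar s_k` moves the coefficient `S` of the last row onto the
diagonal. Multiplying `ξ 0` by one block after the other, modulo covectors supported further down,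
gives `S`.
-/

namespace TypeC

open Matrix

section Coordinates

variable {n i : ℕ}

theorem mat_mul (g h : G n) : mat (g * h) = mat g * mat h := rfl

theorem mat_one : mat (1 : G n) = 1 := rfl

theorem mat_injective : Function.Injective (mat : G n → Matrix (Idx n) (Idx n) ℂ) :=
  fun _ _ h => Subtype.ext (Units.ext h)

theorem mat_x (n i : ℕ) (t : ℂ) : mat (x n i t) = 1 + t • e n i := exp_smul_eq (e_sq n i) t

theorem mat_y (n i : ℕ) (t : ℂ) : mat (y n i t) = 1 + t • f n i := exp_smul_eq (f_sq n i) t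

theorem mat_coroot (n i : ℕ) (c : ℂˣ) :
    mat (coroot n i c) = diagonal fun a => ((c ^ hWeight n i a : ℂˣ) : ℂ) := rfl

theorem pos_injective (n : ℕ) : Function.Injective (pos n) := by
  rintro (a | a) (b | b) h <;> simp only [pos] at h
  · exact congrArg Sum.inl (Fin.ext h)
  · omega
  · omega
  · exact congrArg Sum.inr (Fin.ext (by omega))

theorem pos_lt (a : Idx n) : pos n a < 2 * n := by
  rcases a with a | a <;> simp only [pos] <;> omega

theorem exists_pos_eq {p : ℕ} (hp : p < 2 * n) : ∃ a, pos n a = p := by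
  by_cases h : p < n
  · exact ⟨Sum.inl ⟨p, h⟩, rfl⟩
  · exact ⟨Sum.inr ⟨2 * n - 1 - p, by omega⟩, by simp only [pos]; omega⟩

/-- The adjacent positions `p` and `p + 1` are the two rungs of a copy of the standard
representation of the `SL₂` attached to `i`; for `1 ≤ i ≤ n` this happens for `p = i - 1` and
`p = 2 n - 1 - i`, which coincide for `i = n`. -/
abbrev IsStep (n i p : ℕ) : Prop := p + 1 = i ∨ p + 1 + i = 2 * n

/-- Position `p` is one of the two ends of a step of `i`, so that the `SL₂` attached to `i` does
not act trivially there. -/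
abbrev IsMoved (n i p : ℕ) : Prop := IsStep n i p ∨ p = i ∨ p + i = 2 * n

theorem isStep_or_isStep_pred_or_not_isMoved (hi : 1 ≤ i) (hin : i ≤ n) (p : ℕ) :
    IsStep n i p ∨ (∃ q, p = q + 1 ∧ IsStep n i q) ∨ ¬ IsMoved n i p := by
  by_cases hp : p = i ∨ p + i = 2 * n
  · exact Or.inr (Or.inl ⟨p - 1, by omega, by omega⟩)
  · by_cases hp' : IsStep n i p
    · exact Or.inl hp'
    · exact Or.inr (Or.inr (by omega))

theorem e_apply (hin : i ≤ n) (a b : Idx n) :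
    e n i a b = if pos n b = pos n a + 1 ∧ IsStep n i (pos n a) then 1 else 0 := by
  rcases a with a | a <;> rcases b with b | b <;>
    simp only [e, pos, fromBlocks_apply₁₁, fromBlocks_apply₁₂, fromBlocks_apply₂₁,
      fromBlocks_apply₂₂, of_apply, Matrix.zero_apply]
  case inr.inl => exact (if_neg (by omega)).symm
  all_goals exact if_congr (by omega) rfl rfl

theorem f_apply (hin : i ≤ n) (a b : Idx n) :
    f n i a b = if pos n a = pos n b + 1 ∧ IsStep n i (pos n b) then 1 else 0 := by
  rw [f_eq, transpose_apply, e_apply hin]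

/-- The coordinate covector reading off the coefficient of the basis vector at position `p`; it is
zero if `2 n ≤ p`. -/
def coord (n p : ℕ) : Idx n → ℂ := fun a => if pos n a = p then 1 else 0

theorem coord_pos (a : Idx n) : coord n (pos n a) = Pi.single a 1 := by
  ext b
  simp only [coord, Pi.single_apply, (pos_injective n).eq_iff]

theorem coord_pos_vecMul (a : Idx n) (M : Matrix (Idx n) (Idx n) ℂ) :
    coord n (pos n a) ᵥ* M = M a := by
  rw [coord_pos, single_one_vecMul]; rfl

theorem coord_eq_zero {p : ℕ} (hp : 2 * n ≤ p) : coord n p = 0 := by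
  ext a
  exact if_neg (by have := pos_lt a; omega)

theorem ext_coord {g h : G n}
    (H : ∀ p, coord n p ᵥ* mat g = coord n p ᵥ* mat h) : g = h := by
  refine mat_injective (funext fun a => ?_)
  simpa only [coord_pos_vecMul] using H (pos n a)

theorem coord_vecMul_e (hi : 1 ≤ i) (hin : i ≤ n) (p : ℕ) :
    coord n p ᵥ* e n i = if IsStep n i p then coord n (p + 1) else 0 := by
  rcases lt_or_ge p (2 * n) with hp | hp
  · obtain ⟨a, rfl⟩ := exists_pos_eq hp
    rw [coord_pos_vecMul]
    ext b
    rw [e_apply hin]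
    by_cases h : IsStep n i (pos n a) <;> simp [h, coord]
  · rw [coord_eq_zero hp, zero_vecMul, if_neg (by omega)]

theorem coord_vecMul_f (hin : i ≤ n) {p : ℕ} (hp : ∀ q, p = q + 1 → ¬ IsStep n i q) :
    coord n p ᵥ* f n i = 0 := by
  rcases lt_or_ge p (2 * n) with hp' | hp'
  · obtain ⟨a, rfl⟩ := exists_pos_eq hp'
    ext b
    rw [coord_pos_vecMul, f_apply hin, if_neg fun h => hp _ h.1 h.2]
    rfl
  · rw [coord_eq_zero hp', zero_vecMul]

theorem coord_succ_vecMul_f (hi : 1 ≤ i) (hin : i ≤ n) {p : ℕ} (hp : IsStep n i p) :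
    coord n (p + 1) ᵥ* f n i = coord n p := by
  obtain ⟨a, ha⟩ := exists_pos_eq (n := n) (p := p + 1) (by omega)
  ext b
  rw [← ha, coord_pos_vecMul, f_apply hin, ha]
  exact if_congr (by omega) rfl rfl

end Coordinates

section RankOne

variable {n i p : ℕ}

theorem coord_vecMul_x (hi : 1 ≤ i) (hin : i ≤ n) (hp : IsStep n i p) (t : ℂ) :
    coord n p ᵥ* mat (x n i t) = coord n p + t • coord n (p + 1) := by
  rw [mat_x, vecMul_add, vecMul_one, vecMul_smul, coord_vecMul_e hi hin, if_pos hp]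

theorem coord_vecMul_x_of_not_isStep (hi : 1 ≤ i) (hin : i ≤ n) (hp : ¬ IsStep n i p) (t : ℂ) :
    coord n p ᵥ* mat (x n i t) = coord n p := by
  rw [mat_x, vecMul_add, vecMul_one, vecMul_smul, coord_vecMul_e hi hin, if_neg hp, smul_zero,
    add_zero]

theorem coord_succ_vecMul_x (hi : 1 ≤ i) (hin : i ≤ n) (hp : IsStep n i p) (t : ℂ) :
    coord n (p + 1) ᵥ* mat (x n i t) = coord n (p + 1) :=
  coord_vecMul_x_of_not_isStep hi hin (by omega) t

theorem coord_succ_vecMul_y (hi : 1 ≤ i) (hin : i ≤ n) (hp : IsStep n i p) (t : ℂ) :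
    coord n (p + 1) ᵥ* mat (y n i t) = coord n (p + 1) + t • coord n p := by
  rw [mat_y, vecMul_add, vecMul_one, vecMul_smul, coord_succ_vecMul_f hi hin hp]

theorem coord_vecMul_y_of_isStep_or_not_isMoved (hin : i ≤ n)
    (hp : IsStep n i p ∨ ¬ IsMoved n i p) (t : ℂ) :
    coord n p ᵥ* mat (y n i t) = coord n p := by
  rw [mat_y, vecMul_add, vecMul_one, vecMul_smul, coord_vecMul_f hin fun q hq => by omega,
    smul_zero, add_zero]

theorem hWeight_eq (hi : 1 ≤ i) (hin : i ≤ n) (a : Idx n) :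
    hWeight n i a =
      if IsStep n i (pos n a) then 1 else if IsMoved n i (pos n a) then -1 else 0 := by
  rcases a with a | a <;> simp only [hWeight, pos] <;> split_ifs <;> omega

theorem coord_vecMul_coroot_eq (hi : 1 ≤ i) (hin : i ≤ n) (p : ℕ) (c : ℂˣ) :
    coord n p ᵥ* mat (coroot n i c) =
      ((c ^ (if IsStep n i p then 1 else if IsMoved n i p then -1 else 0 : ℤ) : ℂˣ) : ℂ) •
        coord n p := by
  rcases lt_or_ge p (2 * n) with hp | hp
  · obtain ⟨a, rfl⟩ := exists_pos_eq hp
    ext b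
    rw [coord_pos_vecMul, mat_coroot, diagonal_apply, hWeight_eq hi hin, Pi.smul_apply, coord_pos,
      Pi.single_apply, smul_eq_mul, mul_ite, mul_one, mul_zero]
    exact if_congr eq_comm rfl rfl
  · rw [coord_eq_zero hp, zero_vecMul, smul_zero]

theorem coord_vecMul_coroot (hi : 1 ≤ i) (hin : i ≤ n) (hp : IsStep n i p) (c : ℂˣ) :
    coord n p ᵥ* mat (coroot n i c) = (c : ℂ) • coord n p := by
  rw [coord_vecMul_coroot_eq hi hin, if_pos hp, zpow_one]

theorem coord_succ_vecMul_coroot (hi : 1 ≤ i) (hin : i ≤ n) (hp : IsStep n i p) (c : ℂˣ) :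
    coord n (p + 1) ᵥ* mat (coroot n i c) = ((c⁻¹ : ℂˣ) : ℂ) • coord n (p + 1) := by
  rw [coord_vecMul_coroot_eq hi hin, if_neg (by omega), if_pos (by omega), _root_.zpow_neg_one]

theorem coord_vecMul_coroot_of_not_isMoved (hi : 1 ≤ i) (hin : i ≤ n) (hp : ¬ IsMoved n i p)
    (c : ℂˣ) : coord n p ᵥ* mat (coroot n i c) = coord n p := by
  rw [coord_vecMul_coroot_eq hi hin, if_neg (fun h => hp (Or.inl h)), if_neg hp, zpow_zero,
    Units.val_one, one_smul]

theorem coord_vecMul_sBar (hi : 1 ≤ i) (hin : i ≤ n) (hp : IsStep n i p) :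
    coord n p ᵥ* mat (sBar n i) = -coord n (p + 1) := by
  simp only [sBar, mat_mul, ← vecMul_vecMul, add_vecMul, smul_vecMul, coord_vecMul_x hi hin hp,
    coord_succ_vecMul_x hi hin hp, coord_succ_vecMul_y hi hin hp,
    coord_vecMul_y_of_isStep_or_not_isMoved hin (Or.inl hp)]
  module

theorem coord_succ_vecMul_sBar (hi : 1 ≤ i) (hin : i ≤ n) (hp : IsStep n i p) :
    coord n (p + 1) ᵥ* mat (sBar n i) = coord n p := by
  simp only [sBar, mat_mul, ← vecMul_vecMul, add_vecMul, smul_vecMul, coord_vecMul_x hi hin hp,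
    coord_succ_vecMul_x hi hin hp, coord_succ_vecMul_y hi hin hp]
  module

theorem coord_vecMul_sBar_of_not_isMoved (hi : 1 ≤ i) (hin : i ≤ n) (hp : ¬ IsMoved n i p) :
    coord n p ᵥ* mat (sBar n i) = coord n p := by
  have hp' : ¬ IsStep n i p := fun h => hp (Or.inl h)
  simp only [sBar, mat_mul, ← vecMul_vecMul, coord_vecMul_x_of_not_isStep hi hin hp',
    coord_vecMul_y_of_isStep_or_not_isMoved hin (Or.inr hp)]

theorem coord_vecMul_yBold (hi : 1 ≤ i) (hin : i ≤ n) (hp : IsStep n i p) (c : ℂˣ) :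
    coord n p ᵥ* mat (yBold n i c) = (c : ℂ)⁻¹ • coord n p := by
  rw [yBold, mat_mul, ← vecMul_vecMul, coord_vecMul_y_of_isStep_or_not_isMoved hin (Or.inl hp),
    coord_vecMul_coroot hi hin hp, Units.val_inv_eq_inv_val]

theorem coord_succ_vecMul_yBold (hi : 1 ≤ i) (hin : i ≤ n) (hp : IsStep n i p) (c : ℂˣ) :
    coord n (p + 1) ᵥ* mat (yBold n i c) = (c : ℂ) • coord n (p + 1) + coord n p := by
  rw [yBold, mat_mul, ← vecMul_vecMul, coord_succ_vecMul_y hi hin hp, add_vecMul, smul_vecMul,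
    coord_vecMul_coroot hi hin hp, coord_succ_vecMul_coroot hi hin hp, inv_inv, smul_smul,
    Units.mul_inv, one_smul]

theorem coord_vecMul_yBold_of_not_isMoved (hi : 1 ≤ i) (hin : i ≤ n) (hp : ¬ IsMoved n i p)
    (c : ℂˣ) : coord n p ᵥ* mat (yBold n i c) = coord n p := by
  rw [yBold, mat_mul, ← vecMul_vecMul,
    coord_vecMul_y_of_isStep_or_not_isMoved hin (Or.inr hp),
    coord_vecMul_coroot_of_not_isMoved hi hin hp]

theorem x_mul_y (hi : 1 ≤ i) (hin : i ≤ n) {a s : ℂ} {c : ℂˣ} (hc : (c : ℂ) = 1 + a * s) :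
    x n i a * y n i s = y n i (s / c) * coroot n i c * x n i (a / c) := by
  have hc0 : (c : ℂ) ≠ 0 := c.ne_zero
  refine ext_coord fun p => ?_
  simp only [mat_mul, ← vecMul_vecMul]
  obtain hp | ⟨q, rfl, hp⟩ | hp := isStep_or_isStep_pred_or_not_isMoved hi hin p
  · simp only [coord_vecMul_x hi hin hp, coord_succ_vecMul_y hi hin hp,
      coord_vecMul_y_of_isStep_or_not_isMoved hin (Or.inl hp), coord_vecMul_coroot hi hin hp,
      add_vecMul, smul_vecMul, smul_add, smul_smul, mul_div_cancel₀ _ hc0]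
    rw [hc]
    module
  · simp only [coord_succ_vecMul_x hi hin hp, coord_vecMul_x hi hin hp,
      coord_succ_vecMul_y hi hin hp, coord_vecMul_coroot hi hin hp,
      coord_succ_vecMul_coroot hi hin hp, add_vecMul, smul_vecMul, smul_add, smul_smul,
      Units.val_inv_eq_inv_val]
    match_scalars
    · field_simp
      rw [hc]
      ring
    · field_simp
  · have hp' : ¬ IsStep n i p := fun h => hp (Or.inl h)
    simp only [coord_vecMul_x_of_not_isStep hi hin hp',
      coord_vecMul_coroot_of_not_isMoved hi hin hp,
      coord_vecMul_y_of_isStep_or_not_isMoved hin (Or.inr hp)]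

end RankOne

section BlockTriangular

variable {m R α : Type*} [Fintype m] [NonUnitalNonAssocSemiring R] {M N : Matrix m m R}

theorem submatrix_mul_of_left {l : Type*} [Fintype l] {r : l → m} (hr : Function.Injective r)
    (hM : ∀ a, ∀ b ∉ Set.range r, M (r a) b = 0) :
    (M * N).submatrix r r = M.submatrix r r * N.submatrix r r := by
  ext a b
  rw [submatrix_apply, Matrix.mul_apply, Matrix.mul_apply]
  exact (Fintype.sum_of_injective r hr _ _ (fun c hc => by rw [hM a c hc, zero_mul])
    fun _ => rfl).symm

theorem submatrix_mul_of_right {l : Type*} [Fintype l] {r : l → m} (hr : Function.Injective r)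
    (hN : ∀ a, ∀ b ∉ Set.range r, N b (r a) = 0) :
    (M * N).submatrix r r = M.submatrix r r * N.submatrix r r := by
  ext a b
  rw [submatrix_apply, Matrix.mul_apply, Matrix.mul_apply]
  exact (Fintype.sum_of_injective r hr _ _ (fun c hc => by rw [hN b c hc, mul_zero])
    fun _ => rfl).symm

variable [LinearOrder α] {r : m → α}

theorem blockTriangular_mul_apply_self (hr : Function.Injective r) (hM : M.BlockTriangular r)
    (hN : N.BlockTriangular r) (a : m) : (M * N) a a = M a a * N a a := by
  rw [Matrix.mul_apply]
  refine Finset.sum_eq_single_of_mem a (Finset.mem_univ _) fun c _ hc => ?_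
  rcases lt_or_gt_of_ne (hr.ne hc) with h | h
  · rw [hM h, zero_mul]
  · rw [hN h, mul_zero]

theorem blockTriangular_mul_apply_of_covBy (hr : Function.Injective r) (hM : M.BlockTriangular r)
    (hN : N.BlockTriangular r) {a b : m} (hab : r a ⋖ r b) :
    (M * N) a b = M a a * N a b + M a b * N b b := by
  rw [Matrix.mul_apply]
  refine Finset.sum_eq_add a b (fun h => hab.ne (congrArg r h)) (fun c _ hc => ?_) (by simp)
    (by simp)
  rcases lt_or_gt_of_ne (hr.ne hc.1) with h | h
  · rw [hM h, zero_mul]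
  · rw [hN (lt_of_le_of_ne (hab.ge_of_gt h) (hr.ne hc.2.symm)), mul_zero]

theorem blockTriangular_mul_apply_eq_zero (hM : M.BlockTriangular r)
    (hN : ∀ a b, r b ≤ r a → N a b = 0) (a b : m) (hab : r b ≤ r a) : (M * N) a b = 0 := by
  rw [Matrix.mul_apply]
  refine Finset.sum_eq_zero fun c _ => ?_
  rcases lt_or_ge (r c) (r a) with h | h
  · rw [hM h, zero_mul]
  · rw [hN c b (hab.trans h), mul_zero]

theorem mul_blockTriangular_apply_eq_zero (hM : ∀ a b, r b ≤ r a → M a b = 0)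
    (hN : N.BlockTriangular r) (a b : m) (hab : r b ≤ r a) : (M * N) a b = 0 := by
  rw [Matrix.mul_apply]
  refine Finset.sum_eq_zero fun c _ => ?_
  rcases lt_or_ge (r b) (r c) with h | h
  · rw [hN h, mul_zero]
  · rw [hM a c (h.trans hab), zero_mul]

end BlockTriangular

section Triangular

variable {n i : ℕ} {g h t u v : G n}

theorem mat_inv (g : G n) : mat g⁻¹ = (mat g)⁻¹ := coe_units_inv g.val

theorem blockTriangular_mat_inv {α : Type*} [LinearOrder α] {r : Idx n → α}
    (hg : (mat g).BlockTriangular r) : (mat g⁻¹).BlockTriangular r := by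
  have : Invertible (mat g) := g.val.invertible
  rw [mat_inv]
  exact blockTriangular_inv_of_blockTriangular hg

theorem IsUPlus.blockTriangular (hg : IsUPlus g) : (mat g).BlockTriangular (pos n) := hg.2

theorem IsUMinus.blockTriangular (hg : IsUMinus g) :
    (mat g).BlockTriangular (OrderDual.toDual ∘ pos n) := hg.2

theorem IsTorus.blockTriangular {α : Type*} [LinearOrder α] (hg : IsTorus g) (r : Idx n → α) :
    (mat g).BlockTriangular r :=
  fun _ _ hab => hg fun h => hab.ne (congrArg r h).symm

theorem isUPlus_iff : IsUPlus g ↔ ∀ a b, pos n b ≤ pos n a → (mat g - 1) a b = 0 := by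
  refine ⟨fun hg a b hab => ?_, fun hg => ⟨fun a => ?_, fun a b hab => ?_⟩⟩
  · rcases hab.eq_or_lt with h | h
    · rw [pos_injective n h, Matrix.sub_apply, hg.1, one_apply_eq, sub_self]
    · rw [Matrix.sub_apply, hg.2 a b h, one_apply_ne (fun hab => h.ne (congrArg (pos n) hab).symm),
        sub_self]
  · simpa [sub_eq_zero] using hg a a le_rfl
  · simpa [sub_eq_zero, one_apply_ne (show a ≠ b from fun h => hab.ne (congrArg (pos n) h).symm)]
      using hg a b hab.le

theorem IsUPlus.mul (hg : IsUPlus g) (hh : IsUPlus h) : IsUPlus (g * h) := by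
  refine ⟨fun a => ?_, fun a b hab => hg.blockTriangular.mul hh.blockTriangular hab⟩
  rw [mat_mul, blockTriangular_mul_apply_self (pos_injective n) hg.blockTriangular
    hh.blockTriangular, hg.1, hh.1, mul_one]

theorem IsUPlus.inv (hg : IsUPlus g) : IsUPlus g⁻¹ := by
  have hinv := blockTriangular_mat_inv hg.blockTriangular
  refine ⟨fun a => ?_, fun a b hab => hinv hab⟩
  have := blockTriangular_mul_apply_self (pos_injective n) hg.blockTriangular hinv a
  rw [← mat_mul, mul_inv_cancel, mat_one, one_apply_eq, hg.1, one_mul] at this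
  exact this.symm

theorem IsUMinus.mul (hg : IsUMinus g) (hh : IsUMinus h) : IsUMinus (g * h) := by
  refine ⟨fun a => ?_, fun a b hab => hg.blockTriangular.mul hh.blockTriangular hab⟩
  rw [mat_mul, blockTriangular_mul_apply_self
    (OrderDual.toDual.injective.comp (pos_injective n)) hg.blockTriangular hh.blockTriangular,
    hg.1, hh.1, mul_one]

theorem IsTorus.mul (hg : IsTorus g) (hh : IsTorus h) : IsTorus (g * h) := by
  rw [IsTorus, mat_mul, ← hg.diagonal_diag, ← hh.diagonal_diag, diagonal_mul_diagonal]
  exact isDiag_diagonal _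

theorem IsUMinus.conj_torus (hu : IsUMinus u) (ht : IsTorus t) : IsUMinus (t * u * t⁻¹) := by
  have hr := OrderDual.toDual.injective.comp (pos_injective n)
  have htu := (ht.blockTriangular (OrderDual.toDual ∘ pos n)).mul hu.blockTriangular
  have hinv := blockTriangular_mat_inv (ht.blockTriangular (OrderDual.toDual ∘ pos n))
  refine ⟨fun a => ?_, fun a b hab => htu.mul hinv hab⟩
  rw [mat_mul, mat_mul, blockTriangular_mul_apply_self hr htu hinv,
    blockTriangular_mul_apply_self hr (ht.blockTriangular _) hu.blockTriangular, hu.1, mul_one,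
    ← blockTriangular_mul_apply_self hr (ht.blockTriangular _) hinv, ← mat_mul, mul_inv_cancel,
    mat_one, one_apply_eq]

theorem isTorus_coroot (n i : ℕ) (c : ℂˣ) : IsTorus (coroot n i c) := isDiag_diagonal _

theorem isTorus_one : IsTorus (1 : G n) := isDiag_one

theorem isUPlus_one : IsUPlus (1 : G n) := isUPlus_iff.2 fun a b _ => by simp [mat_one]

theorem isUMinus_one : IsUMinus (1 : G n) :=
  ⟨fun a => one_apply_eq a, fun _ _ hab => one_apply_ne fun h => hab.ne (congrArg (pos n) h)⟩

theorem isUPlus_x (hin : i ≤ n) (s : ℂ) : IsUPlus (x n i s) := by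
  refine isUPlus_iff.2 fun a b hab => ?_
  rw [mat_x, add_sub_cancel_left, Matrix.smul_apply, e_apply hin, if_neg (by omega), smul_zero]

theorem isUMinus_y (hin : i ≤ n) (s : ℂ) : IsUMinus (y n i s) := by
  refine ⟨fun a => ?_, fun a b hab => ?_⟩
  · rw [mat_y, Matrix.add_apply, one_apply_eq, Matrix.smul_apply, f_apply hin, if_neg (by omega),
      smul_zero, add_zero]
  · rw [mat_y, Matrix.add_apply, one_apply_ne fun h => hab.ne (congrArg (pos n) h),
      Matrix.smul_apply, f_apply hin, if_neg (by omega), smul_zero, add_zero]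

end Triangular

section LeadingMinor

variable {n k : ℕ}

/-- The embedding of `Fin k` onto the indices of the first `k` basis vectors `v_1, …, v_k`. -/
def leadingIdx (hk : k ≤ n) : Fin k → Idx n := Sum.inl ∘ Fin.castLE hk

theorem pos_leadingIdx (hk : k ≤ n) (a : Fin k) : pos n (leadingIdx hk a) = a := rfl

theorem leadingIdx_injective (hk : k ≤ n) : Function.Injective (leadingIdx hk) :=
  Sum.inl_injective.comp (Fin.castLE_injective hk)

theorem le_pos_of_notMem_range (hk : k ≤ n) {b : Idx n} (hb : b ∉ Set.range (leadingIdx hk)) :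
    k ≤ pos n b := by
  by_contra! h
  exact hb ⟨⟨pos n b, h⟩, pos_injective n rfl⟩

/-- The minor of `g` on its first `k` rows and columns. -/
noncomputable def leadingMinor (hk : k ≤ n) (g : G n) : ℂ :=
  ((mat g).submatrix (leadingIdx hk) (leadingIdx hk)).det

theorem isRegular_leadingMinor (hk : k ≤ n) : IsRegular (leadingMinor hk) := by
  refine ⟨(of fun a b => MvPolynomial.X (leadingIdx hk a, leadingIdx hk b)).det, fun g => ?_⟩
  rw [RingHom.map_det]
  refine congrArg det ?_
  ext a b
  simp

theorem leadingMinor_of_isUPlus (hk : k ≤ n) {v : G n} (hv : IsUPlus v) :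
    leadingMinor hk v = 1 := by
  have htri : ((mat v).submatrix (leadingIdx hk) (leadingIdx hk)).IsUpperTriangular :=
    fun _ _ h => hv.2 _ _ h
  rw [leadingMinor, det_of_isUpperTriangular htri]
  simp [hv.1]

theorem leadingMinor_of_isUMinus (hk : k ≤ n) {u : G n} (hu : IsUMinus u) :
    leadingMinor hk u = 1 := by
  have htri : ((mat u).submatrix (leadingIdx hk) (leadingIdx hk))ᵀ.IsUpperTriangular :=
    fun _ _ h => hu.2 _ _ h
  rw [leadingMinor, ← det_transpose, det_of_isUpperTriangular htri]
  simp [hu.1]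

theorem leadingMinor_of_isTorus (hk : k ≤ n) {t : G n} (ht : IsTorus t) :
    leadingMinor hk t = fundWeight n k t := by
  rw [leadingMinor, ← (IsDiag.submatrix ht (leadingIdx_injective hk)).diagonal_diag, det_diagonal]
  exact Fintype.prod_equiv (Fin.castLEquiv hk) _ _ fun _ => rfl

theorem isPrincipalMinor_leadingMinor (hk : k ≤ n) :
    IsPrincipalMinor (fundWeight n k) (leadingMinor hk) := by
  refine ⟨isRegular_leadingMinor hk, fun u t v hu ht hv => ?_⟩
  have hr := leadingIdx_injective hk
  have hlt (a : Fin k) {b : Idx n} (hb : b ∉ Set.range (leadingIdx hk)) :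
      pos n (leadingIdx hk a) < pos n b := a.2.trans_le (le_pos_of_notMem_range hk hb)
  rw [leadingMinor, mat_mul, mat_mul, submatrix_mul_of_right hr fun a b hb => hv.2 _ _ (hlt a hb),
    submatrix_mul_of_left hr fun a b hb => hu.2 _ _ (hlt a hb), det_mul, det_mul]
  change leadingMinor hk u * leadingMinor hk t * leadingMinor hk v = _
  rw [leadingMinor_of_isUMinus hk hu, leadingMinor_of_isUPlus hk hv, leadingMinor_of_isTorus hk ht,
    one_mul, mul_one]

end LeadingMinor

section Superdiagonal

variable {n i : ℕ}

theorem pos_swap (a : Idx n) : pos n a.swap = 2 * n - 1 - pos n a := by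
  rcases a with a | a <;> simp only [Sum.swap_inl, Sum.swap_inr, pos]
  omega

theorem form_apply (a b : Idx n) : form n a b = if a.swap = b then (-1) ^ (pos n a + 1) else 0 := by
  rcases a with a | a <;> rcases b with b | b <;>
    simp only [form, formSign, fromBlocks_apply₁₁, fromBlocks_apply₁₂, fromBlocks_apply₂₁,
      fromBlocks_apply₂₂, Matrix.zero_apply, Matrix.neg_apply, diagonal_apply, Sum.swap_inl,
      Sum.swap_inr, Sum.inl.injEq, Sum.inr.injEq, reduceCtorEq, if_false, pos]
  split_ifs with h
  · rw [pow_succ, show 2 * n - 1 - a + 1 = 2 * (n - a) + a by omega, pow_add, pow_mul, neg_one_sq,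
      one_pow, one_mul, mul_neg_one, neg_neg]
  · exact neg_zero

theorem form_mul_apply (M : Matrix (Idx n) (Idx n) ℂ) (a b : Idx n) :
    (form n * M) a b = (-1) ^ (pos n a + 1) * M a.swap b := by
  simp only [Matrix.mul_apply, form_apply, ite_mul, zero_mul, Finset.sum_ite_eq, Finset.mem_univ,
    if_true]

theorem mul_form_apply (M : Matrix (Idx n) (Idx n) ℂ) (a b : Idx n) :
    (M * form n) a b.swap = (-1) ^ (pos n b + 1) * M a b := by
  simp only [Matrix.mul_apply, form_apply, mul_ite, mul_zero, Sum.swap_leftInverse.injective.eq_iff,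
    Finset.sum_ite_eq', Finset.mem_univ, if_true, mul_comm]

theorem form_mul_mat (g : G n) : form n * mat g = (mat g⁻¹)ᵀ * form n := by
  have hg : (mat g)ᵀ * form n * mat g = form n := g.2
  have hinv : (mat g⁻¹)ᵀ * (mat g)ᵀ = 1 := by
    rw [← transpose_mul, ← mat_mul, mul_inv_cancel, mat_one, transpose_one]
  calc form n * mat g = (mat g⁻¹)ᵀ * (mat g)ᵀ * (form n * mat g) := by rw [hinv, Matrix.one_mul]
    _ = (mat g⁻¹)ᵀ * form n := by rw [Matrix.mul_assoc, ← Matrix.mul_assoc _ (form n), hg]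

theorem IsUPlus.apply_swap_swap {v : G n} (hv : IsUPlus v) {a b : Idx n}
    (hab : pos n b = pos n a + 1) : mat v b.swap a.swap = mat v a b := by
  have hcov : pos n b.swap ⋖ pos n a.swap := by
    have := pos_lt b
    rw [pos_swap, pos_swap, Nat.covBy_iff_add_one_eq]
    omega
  have hinv : mat v⁻¹ b.swap a.swap = -mat v b.swap a.swap := by
    have h := blockTriangular_mul_apply_of_covBy (pos_injective n) hv.inv.blockTriangular
      hv.blockTriangular hcov
    rw [← mat_mul, inv_mul_cancel, mat_one, one_apply_ne fun h => hcov.ne (congrArg (pos n) h),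
      hv.1, hv.inv.1, one_mul, mul_one] at h
    linear_combination -h
  have hform := congrFun₂ (form_mul_mat v) a.swap b
  rw [form_mul_apply, Sum.swap_swap, ← b.swap_swap, mul_form_apply, transpose_apply, hinv,
    Sum.swap_swap, ← (Nat.covBy_iff_add_one_eq.1 hcov), pow_succ] at hform
  have hsign : (-1 : ℂ) ^ (pos n b.swap + 1) ≠ 0 := pow_ne_zero _ (by norm_num)
  refine mul_left_cancel₀ hsign ?_
  linear_combination hform

theorem IsUPlus.exists_forall_step_apply_eq (hi : 1 ≤ i) (hin : i ≤ n) {v : G n} (hv : IsUPlus v) :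
    ∃ s, ∀ a b, IsStep n i (pos n a) → pos n b = pos n a + 1 → mat v a b = s := by
  obtain ⟨a₀, ha₀⟩ := exists_pos_eq (n := n) (p := i - 1) (by omega)
  obtain ⟨b₀, hb₀⟩ := exists_pos_eq (n := n) (p := i) (by omega)
  refine ⟨mat v a₀ b₀, fun a b ha hab => ?_⟩
  by_cases h : pos n a = i - 1
  · rw [pos_injective n (h.trans ha₀.symm), pos_injective n (show pos n b = pos n b₀ by omega)]
  · rw [← hv.apply_swap_swap hab, pos_injective n (show pos n b.swap = pos n a₀ by
      rw [pos_swap]; omega), pos_injective n (show pos n a.swap = pos n b₀ by rw [pos_swap]; omega)]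

end Superdiagonal

section Parabolic

variable {n i : ℕ}

/-- The order of the basis in which the two ends of each step of `i` are identified, so that the
block upper triangular matrices are those of the `i`-th minimal parabolic subgroup. -/
def parabolicBlock (n i : ℕ) (a : Idx n) : ℕ :=
  if pos n a = i ∨ pos n a + i = 2 * n then pos n a - 1 else pos n a

theorem parabolicBlock_le (n i : ℕ) {a b : Idx n} (hab : pos n a ≤ pos n b) :
    parabolicBlock n i a ≤ parabolicBlock n i b := by
  unfold parabolicBlock
  split_ifs <;> omega

theorem blockTriangular_y (hi : 1 ≤ i) (hin : i ≤ n) (s : ℂ) :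
    (mat (y n i s)).BlockTriangular (parabolicBlock n i) := by
  rw [mat_y]
  refine blockTriangular_one.add fun a b hab => ?_
  rw [Matrix.smul_apply, f_apply hin, if_neg, smul_zero]
  unfold parabolicBlock at hab
  split_ifs at hab <;> omega

theorem inv_oneParam {N : Matrix (Idx n) (Idx n) ℂ} (hN : N * N = 0)
    (hf : Nᵀ * form n = -(form n * N)) (s : ℂ) : (oneParam N hN hf s)⁻¹ = oneParam N hN hf (-s) :=
  mat_injective (congrArg IsNilpotent.exp (neg_smul s N).symm)

theorem inv_x (n i : ℕ) (s : ℂ) : (x n i s)⁻¹ = x n i (-s) := inv_oneParam _ _ s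

theorem inv_y (n i : ℕ) (s : ℂ) : (y n i s)⁻¹ = y n i (-s) := inv_oneParam _ _ s

theorem IsUPlus.conj_y (hi : 1 ≤ i) (hin : i ≤ n) {v : G n} (hv : IsUPlus v)
    (hstep : ∀ a b, IsStep n i (pos n a) → pos n b = pos n a + 1 → mat v a b = 0) (s : ℂ) :
    IsUPlus ((y n i s)⁻¹ * v * y n i s) := by
  have hrad (a b : Idx n) (hab : parabolicBlock n i b ≤ parabolicBlock n i a) :
      (mat v - 1) a b = 0 := by
    rcases le_or_gt (pos n b) (pos n a) with h | h
    · exact isUPlus_iff.1 hv a b h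
    · have hsucc : IsStep n i (pos n a) ∧ pos n b = pos n a + 1 := by
        unfold parabolicBlock at hab
        split_ifs at hab <;> omega
      rw [Matrix.sub_apply, hstep a b hsucc.1 hsucc.2,
        one_apply_ne fun h' => h.ne (congrArg (pos n) h'), sub_zero]
  have hconj : mat ((y n i s)⁻¹ * v * y n i s) - 1 =
      mat (y n i s)⁻¹ * ((mat v - 1) * mat (y n i s)) := by
    rw [Matrix.sub_mul, Matrix.mul_sub, Matrix.one_mul, ← mat_mul, ← mat_mul, ← mat_mul,
      inv_mul_cancel, mat_one, mul_assoc]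
  refine isUPlus_iff.2 fun a b hab => ?_
  rw [hconj, inv_y]
  exact blockTriangular_mul_apply_eq_zero (blockTriangular_y hi hin _)
    (mul_blockTriangular_apply_eq_zero hrad (blockTriangular_y hi hin s)) a b
    (parabolicBlock_le n i hab)

end Parabolic

section BigCell

variable {n i : ℕ}

/-- The big cell `U⁻ T U⁺` of `G`. -/
def bigCell (n : ℕ) : Set (G n) :=
  {g | ∃ u t v, IsUMinus u ∧ IsTorus t ∧ IsUPlus v ∧ g = u * t * v}

theorem one_mem_bigCell : (1 : G n) ∈ bigCell n :=
  ⟨1, 1, 1, isUMinus_one, isTorus_one, isUPlus_one, by simp⟩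

theorem mul_mem_bigCell {g w : G n} (hg : g ∈ bigCell n) (hw : IsUPlus w) : g * w ∈ bigCell n := by
  obtain ⟨u, t, v, hu, ht, hv, rfl⟩ := hg
  exact ⟨u, t, v * w, hu, ht, hv.mul hw, mul_assoc _ _ _⟩

theorem IsUPlus.exists_eq_x_mul (hi : 1 ≤ i) (hin : i ≤ n) {v : G n} (hv : IsUPlus v) :
    ∃ s, ∃ w : G n, v = x n i s * w ∧ IsUPlus w ∧
      ∀ a b, IsStep n i (pos n a) → pos n b = pos n a + 1 → mat w a b = 0 := by
  obtain ⟨s, hs⟩ := hv.exists_forall_step_apply_eq hi hin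
  refine ⟨s, (x n i s)⁻¹ * v, (mul_inv_cancel_left _ _).symm, ?_, fun a b ha hab => ?_⟩
  · exact (isUPlus_x hin s).inv.mul hv
  · have hne : a ≠ b := fun h => by rw [h] at hab; omega
    rw [inv_x, mat_mul, blockTriangular_mul_apply_of_covBy (pos_injective n)
      (isUPlus_x hin _).blockTriangular hv.blockTriangular (Nat.covBy_iff_add_one_eq.2 hab.symm),
      (isUPlus_x hin _).1, hv.1, hs a b ha hab, mat_x, Matrix.add_apply, one_apply_ne hne,
      Matrix.smul_apply, e_apply hin, if_pos ⟨hab, ha⟩, smul_eq_mul]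
    ring

theorem exists_forall_mul_y_mem_bigCell (hi : 1 ≤ i) (hin : i ≤ n) {g : G n} (hg : g ∈ bigCell n) :
    ∃ a : ℂ, ∀ s, 1 + a * s ≠ 0 → g * y n i s ∈ bigCell n := by
  obtain ⟨u, t, v, hu, ht, hv, rfl⟩ := hg
  obtain ⟨a, w, rfl, hw, hstep⟩ := hv.exists_eq_x_mul hi hin
  refine ⟨a, fun s hs => ?_⟩
  obtain ⟨c, hc⟩ : ∃ c : ℂˣ, (c : ℂ) = 1 + a * s := ⟨Units.mk0 _ hs, rfl⟩
  refine ⟨u * (t * y n i (s / c) * t⁻¹), t * coroot n i c,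
    x n i (a / c) * ((y n i s)⁻¹ * w * y n i s), hu.mul ((isUMinus_y hin _).conj_torus ht),
    ht.mul (isTorus_coroot n i c), (isUPlus_x hin _).mul (hw.conj_y hi hin hstep s), ?_⟩
  calc u * t * (x n i a * w) * y n i s
      = u * t * (x n i a * y n i s) * ((y n i s)⁻¹ * w * y n i s) := by group
    _ = u * t * (y n i (s / c) * coroot n i c * x n i (a / c)) *
          ((y n i s)⁻¹ * w * y n i s) := by rw [x_mul_y hi hin hc]
    _ = _ := by group

end BigCell

section Uniqueness

variable {n i : ℕ}

/-- The subgroup of `G` generated by the root subgroups of the simple roots and their opposites. -/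
def elementarySubgroup (n : ℕ) : Subgroup (G n) :=
  Subgroup.closure {g | ∃ i s, 1 ≤ i ∧ i ≤ n ∧ (g = x n i s ∨ g = y n i s)}

theorem x_mem_elementarySubgroup (hi : 1 ≤ i) (hin : i ≤ n) (s : ℂ) :
    x n i s ∈ elementarySubgroup n :=
  Subgroup.subset_closure ⟨i, s, hi, hin, Or.inl rfl⟩

theorem y_mem_elementarySubgroup (hi : 1 ≤ i) (hin : i ≤ n) (s : ℂ) :
    y n i s ∈ elementarySubgroup n :=
  Subgroup.subset_closure ⟨i, s, hi, hin, Or.inr rfl⟩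

theorem sBar_mem_elementarySubgroup (hi : 1 ≤ i) (hin : i ≤ n) : sBar n i ∈ elementarySubgroup n :=
  mul_mem (mul_mem (x_mem_elementarySubgroup hi hin _) (y_mem_elementarySubgroup hi hin _))
    (x_mem_elementarySubgroup hi hin _)

theorem coroot_mem_elementarySubgroup (hi : 1 ≤ i) (hin : i ≤ n) (c : ℂˣ) :
    coroot n i c ∈ elementarySubgroup n := by
  have hc : (c : ℂ) = 1 + 1 * (c - 1) := by ring
  have hcoroot : coroot n i c =
      (y n i ((c - 1) / c))⁻¹ * (x n i 1 * y n i (c - 1)) * (x n i (1 / c))⁻¹ := by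
    rw [x_mul_y hi hin hc]
    group
  rw [hcoroot]
  exact mul_mem (mul_mem (inv_mem (y_mem_elementarySubgroup hi hin _))
    (mul_mem (x_mem_elementarySubgroup hi hin _) (y_mem_elementarySubgroup hi hin _)))
    (inv_mem (x_mem_elementarySubgroup hi hin _))

theorem yBold_mem_elementarySubgroup (hi : 1 ≤ i) (hin : i ≤ n) (c : ℂˣ) :
    yBold n i c ∈ elementarySubgroup n :=
  mul_mem (y_mem_elementarySubgroup hi hin _) (coroot_mem_elementarySubgroup hi hin _)

theorem IsRegular.continuous_mul_y_mul {F : G n → ℂ} (hF : IsRegular F) (i : ℕ) (g h : G n) :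
    Continuous fun s => F (g * y n i s * h) := by
  obtain ⟨P, hP⟩ := hF
  simp only [hP, mat_mul, mat_y]
  refine (MvPolynomial.continuous_eval P).comp (continuous_pi fun ab => ?_)
  exact (by fun_prop : Continuous fun s : ℂ => mat g * (1 + s • f n i) * mat h).matrix_elem _ _

theorem IsRegular.forall_mem_bigCell_eq_mul_y_mul {F F' : G n → ℂ} (hF : IsRegular F)
    (hF' : IsRegular F') (hi : 1 ≤ i) (hin : i ≤ n) {g : G n}
    (hg : ∀ b ∈ bigCell n, F (b * g) = F' (b * g)) (s : ℂ) :
    ∀ b ∈ bigCell n, F (b * (y n i s * g)) = F' (b * (y n i s * g)) := by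
  intro b hb
  obtain ⟨a, ha⟩ := exists_forall_mul_y_mem_bigCell hi hin hb
  have heq : Set.EqOn (fun s => F (b * y n i s * g)) (fun s => F' (b * y n i s * g)) {-a⁻¹}ᶜ := by
    refine fun s hs => hg _ (ha s fun h0 => hs ?_)
    have ha0 : a ≠ 0 := fun h => by simp [h] at h0
    rw [Set.mem_singleton_iff]
    field_simp
    linear_combination h0
  simpa only [mul_assoc] using congrFun ((hF.continuous_mul_y_mul i b g).ext_on
    (dense_compl_singleton _) (hF'.continuous_mul_y_mul i b g) heq) s

theorem IsPrincipalMinor.eqOn_elementarySubgroup {μ F F' : G n → ℂ} (hF : IsPrincipalMinor μ F)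
    (hF' : IsPrincipalMinor μ F') : Set.EqOn F F' (elementarySubgroup n) := by
  suffices H : ∀ g ∈ elementarySubgroup n, ∀ b ∈ bigCell n, F (b * g) = F' (b * g) by
    exact fun g hg => by simpa only [one_mul] using H g hg 1 one_mem_bigCell
  have hx (i : ℕ) (s : ℂ) (hin : i ≤ n) (g : G n)
      (hg : ∀ b ∈ bigCell n, F (b * g) = F' (b * g)) :
      ∀ b ∈ bigCell n, F (b * (x n i s * g)) = F' (b * (x n i s * g)) := fun b hb => by
    simpa only [mul_assoc] using hg _ (mul_mem_bigCell hb (isUPlus_x hin s))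
  intro g hg
  induction hg using Subgroup.closure_induction_left with
  | one =>
    rintro _ ⟨u, t, v, hu, ht, hv, rfl⟩
    rw [mul_one, hF.2 u t v hu ht hv, hF'.2 u t v hu ht hv]
  | mul_left a ha g _ ih =>
    obtain ⟨i, s, hi, hin, rfl | rfl⟩ := ha
    · exact hx i s hin g ih
    · exact hF.1.forall_mem_bigCell_eq_mul_y_mul hF'.1 hi hin ih s
  | inv_mul_cancel a ha g _ ih =>
    obtain ⟨i, s, hi, hin, rfl | rfl⟩ := ha
    · rw [inv_x]
      exact hx i (-s) hin g ih
    · rw [inv_y]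
      exact hF.1.forall_mem_bigCell_eq_mul_y_mul hF'.1 hi hin ih (-s)

end Uniqueness

section OrderedProduct

variable {M : Type*} [Monoid M]

/-- The ordered product `g 1 * g 2 * ⋯ * g m`, indexed from `1` like the words in `longWord`. -/
def orderedProd (g : ℕ → M) (m : ℕ) : M := ((List.range' 1 m).map g).prod

theorem orderedProd_zero (g : ℕ → M) : orderedProd g 0 = 1 := rfl

theorem orderedProd_succ (g : ℕ → M) (m : ℕ) :
    orderedProd g (m + 1) = orderedProd g m * g (m + 1) := by
  rw [orderedProd, List.range'_1_concat, List.map_append, List.prod_append, List.map_singleton,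
    List.prod_singleton, add_comm 1 m, orderedProd]

theorem orderedProd_succ' (g : ℕ → M) (m : ℕ) :
    orderedProd g (m + 1) = g 1 * orderedProd (fun j => g (j + 1)) m := by
  rw [orderedProd, List.range'_succ, List.map_cons, List.prod_cons, orderedProd,
    ← List.map_add_range' (a := 1), List.map_map]
  simp only [Function.comp_def, add_comm 1]

theorem orderedProd_mem {S : Type*} [SetLike S M] [SubmonoidClass S M] (H : S) {g : ℕ → M} {m : ℕ}
    (hg : ∀ j, 1 ≤ j → j ≤ m → g j ∈ H) : orderedProd g m ∈ H := by
  refine list_prod_mem fun a ha => ?_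
  obtain ⟨j, hj, rfl⟩ := List.mem_map.1 ha
  rw [List.mem_range'_1] at hj
  exact hg j hj.1 (by omega)

theorem zipWith_flatten_replicate {α β γ δ : Type*} (g : α → β → γ) (h : δ → α → β) (L : List α)
    (l : List δ) :
    List.zipWith g (List.replicate l.length L).flatten (l.flatMap fun j => L.map (h j)) =
      l.flatMap fun j => L.map fun i => g i (h j i) := by
  induction l with
  | nil => rfl
  | cons j l ih =>
    rw [List.length_cons, List.replicate_succ, List.flatten_cons, List.flatMap_cons,
      List.zipWith_append (by simp), ih, List.flatMap_cons, List.zipWith_map_right,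
      List.zipWith_self]

end OrderedProduct

section LongestElement

variable {n i p m : ℕ}

theorem vecMul_orderedProd_eq {g : ℕ → G n} {ξ η : Idx n → ℂ} {k m : ℕ} (hkm : k ≤ m)
    (hη : η ᵥ* mat (orderedProd g k) = ξ)
    (hξ : ∀ i, k < i → i ≤ m → ξ ᵥ* mat (g i) = ξ) : η ᵥ* mat (orderedProd g m) = ξ := by
  induction m, hkm using Nat.le_induction with
  | base => exact hη
  | succ m hkm ih =>
    rw [orderedProd_succ, mat_mul, ← vecMul_vecMul, ih fun i hk hm => hξ i hk (by omega),
      hξ _ (by omega) le_rfl]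

theorem vecMul_orderedProd_of_fixed {g : ℕ → G n} {ξ : Idx n → ℂ} {m : ℕ}
    (hξ : ∀ i, 1 ≤ i → i ≤ m → ξ ᵥ* mat (g i) = ξ) : ξ ᵥ* mat (orderedProd g m) = ξ :=
  vecMul_orderedProd_eq (Nat.zero_le m) (by rw [orderedProd_zero, mat_one, vecMul_one]) hξ

/-- The covector reading off the coefficient of `v_{\overline{k+1}}`; for `k = n` it is that of
`v_n`, which precedes `v_{\bar n}`. -/
def coordBar (n k : ℕ) : Idx n → ℂ := coord n (2 * n - 1 - k)

theorem coordBar_self (h : p + 1 = n) : coordBar n n = coord n p := by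
  rw [coordBar, show 2 * n - 1 - n = p by omega]

theorem coordBar_eq_succ (hi : i + 1 ≤ n) : coordBar n i = coord n (2 * n - 1 - (i + 1) + 1) := by
  rw [coordBar, show 2 * n - 1 - (i + 1) + 1 = 2 * n - 1 - i by omega]

theorem coordBar_vecMul_sBar (hi : i + 1 ≤ n) :
    coordBar n i ᵥ* mat (sBar n (i + 1)) = coordBar n (i + 1) := by
  rw [coordBar_eq_succ hi, coord_succ_vecMul_sBar (by omega) hi (by omega), coordBar]

theorem coordBar_succ_vecMul_sBar (hi : i + 1 ≤ n) :
    coordBar n (i + 1) ᵥ* mat (sBar n (i + 1)) = -coordBar n i := by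
  rw [coordBar_eq_succ hi, ← coord_vecMul_sBar (by omega) hi (by omega), coordBar]

theorem coordBar_vecMul_yBold (hi : i + 1 ≤ n) (c : ℂˣ) :
    coordBar n i ᵥ* mat (yBold n (i + 1) c) = (c : ℂ) • coordBar n i + coordBar n (i + 1) := by
  rw [coordBar_eq_succ hi, coord_succ_vecMul_yBold (by omega) hi (by omega), coordBar]

theorem coordBar_succ_vecMul_yBold (hi : i + 1 ≤ n) (c : ℂˣ) :
    coordBar n (i + 1) ᵥ* mat (yBold n (i + 1) c) = (c : ℂ)⁻¹ • coordBar n (i + 1) :=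
  coord_vecMul_yBold (by omega) hi (by omega) c

theorem coordBar_vecMul_sBar_of_ne {k : ℕ} (hi : 1 ≤ i) (hin : i ≤ n) (hk : k < n) (hki : k ≠ i)
    (hki' : k + 1 ≠ i) : coordBar n k ᵥ* mat (sBar n i) = coordBar n k :=
  coord_vecMul_sBar_of_not_isMoved hi hin (by omega)

theorem coordBar_vecMul_yBold_of_ne {k : ℕ} (hi : 1 ≤ i) (hin : i ≤ n) (hk : k < n) (hki : k ≠ i)
    (hki' : k + 1 ≠ i) (c : ℂˣ) : coordBar n k ᵥ* mat (yBold n i c) = coordBar n k :=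
  coord_vecMul_yBold_of_not_isMoved hi hin (by omega) c

/-- The representative `\bar s_1 \bar s_2 ⋯ \bar s_n` of a Coxeter element. -/
noncomputable def coxeter (n : ℕ) : G n := orderedProd (sBar n) n

theorem wBar_longWord (n : ℕ) : wBar n (longWord n) = coxeter n ^ n := by
  simp only [wBar, longWord, coxeter, orderedProd, List.map_flatten, List.map_replicate,
    List.prod_flatten, List.prod_replicate]

theorem coord_succ_vecMul_coxeter (hp : p + 2 ≤ n) :
    coord n (p + 1) ᵥ* mat (coxeter n) = coord n p := by
  refine vecMul_orderedProd_eq (k := p + 1) (by omega) ?_ fun i hi hin =>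
    coord_vecMul_sBar_of_not_isMoved (by omega) hin (by omega)
  rw [orderedProd_succ, mat_mul, ← vecMul_vecMul, vecMul_orderedProd_of_fixed fun i hi hip =>
    coord_vecMul_sBar_of_not_isMoved hi (by omega) (by omega),
    coord_succ_vecMul_sBar (by omega) (by omega) (by omega)]

theorem coordBar_zero_vecMul_orderedProd_sBar (hm : m ≤ n) :
    coordBar n 0 ᵥ* mat (orderedProd (sBar n) m) = coordBar n m := by
  induction m with
  | zero => rw [orderedProd_zero, mat_one, vecMul_one]
  | succ m ih => rw [orderedProd_succ, mat_mul, ← vecMul_vecMul, ih (by omega),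
      coordBar_vecMul_sBar hm]

theorem coordBar_succ_vecMul_coxeter (hp : p + 2 ≤ n) :
    coordBar n (p + 1) ᵥ* mat (coxeter n) = -coordBar n p := by
  refine vecMul_orderedProd_eq (k := p + 1) (by omega) ?_ fun i hi hin => ?_
  · rw [orderedProd_succ, mat_mul, ← vecMul_vecMul, vecMul_orderedProd_of_fixed fun i hi hip =>
      coordBar_vecMul_sBar_of_ne hi (by omega) (by omega) (by omega) (by omega),
      coordBar_succ_vecMul_sBar (by omega)]
  · rw [neg_vecMul, coordBar_vecMul_sBar_of_ne (by omega) hin (by omega) (by omega) (by omega)]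

theorem coord_vecMul_coxeter_pow (h : p + m < n) :
    coord n (p + m) ᵥ* mat (coxeter n ^ m) = coord n p := by
  induction m with
  | zero => rw [pow_zero, mat_one, vecMul_one, add_zero]
  | succ m ih => rw [pow_succ', mat_mul, ← vecMul_vecMul, ← add_assoc,
      coord_succ_vecMul_coxeter (by omega), ih (by omega)]

theorem coordBar_vecMul_coxeter_pow (h : m < n) :
    coordBar n m ᵥ* mat (coxeter n ^ m) = (-1 : ℂ) ^ m • coordBar n 0 := by
  induction m with
  | zero => rw [pow_zero, mat_one, vecMul_one, pow_zero, one_smul]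
  | succ m ih => rw [pow_succ', mat_mul, ← vecMul_vecMul, coordBar_succ_vecMul_coxeter (by omega),
      neg_vecMul, ih (by omega), pow_succ, mul_neg_one, neg_smul]

theorem coordBar_vecMul_wBar_longWord (h : m < n) :
    coordBar n m ᵥ* mat (wBar n (longWord n)) = (-1 : ℂ) ^ m • coord n m := by
  obtain ⟨t, rfl⟩ := Nat.exists_eq_add_of_lt h
  rw [wBar_longWord, add_assoc, pow_add, pow_succ', mat_mul, mat_mul, ← vecMul_vecMul,
    ← vecMul_vecMul, ← add_assoc, coordBar_vecMul_coxeter_pow h, smul_vecMul, smul_vecMul, coxeter,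
    coordBar_zero_vecMul_orderedProd_sBar le_rfl, coordBar_self rfl, ← coxeter,
    coord_vecMul_coxeter_pow (Nat.lt_succ_self _)]

theorem coord_vecMul_inv_wBar_longWord (h : m < n) :
    coord n m ᵥ* mat (wBar n (longWord n))⁻¹ = (-1 : ℂ) ^ m • coordBar n m := by
  have hsign : (-1 : ℂ) ^ m * (-1) ^ m = 1 := by rw [← mul_pow]; simp
  have hcoord : coord n m =
      ((-1 : ℂ) ^ m • coordBar n m) ᵥ* mat (wBar n (longWord n)) := by
    rw [smul_vecMul, coordBar_vecMul_wBar_longWord h, smul_smul, hsign, one_smul]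
  rw [hcoord, vecMul_vecMul, ← mat_mul, mul_inv_cancel, mat_one, vecMul_one]

end LongestElement

section ParameterBlocks

variable {n m k p : ℕ} (d : ℕ → ℂˣ) (c : ℕ → ℕ → ℂˣ)

/-- One factor `𝐲_1(d_1) 𝐲_2(d_2) ⋯ 𝐲_n(d_n)` of `Θ^-_{𝐢₀}`. -/
noncomputable def yBlock (n : ℕ) (d : ℕ → ℂˣ) : G n := orderedProd (fun i => yBold n i (d i)) n

/-- The product of the `t` consecutive factors of `Θ^-_{𝐢₀}(c)` with superscripts
`j + 1, …, j + t`. -/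
noncomputable def blockProd (n : ℕ) (c : ℕ → ℕ → ℂˣ) (j t : ℕ) : G n :=
  orderedProd (fun l => yBlock n fun i => c i (j + l)) t

theorem Theta_longWord : Theta n (longWord n) (params n c) = blockProd n c 0 n := by
  have h := zipWith_flatten_replicate (yBold n) (fun j i => c i j) (List.range' 1 n)
    (List.range' 1 n)
  rw [List.length_range'] at h
  rw [Theta, longWord, params, h]
  simp only [List.flatMap_def, List.prod_flatten, List.map_map, blockProd, yBlock, orderedProd,
    Function.comp_def, zero_add]

theorem blockProd_succ (j t : ℕ) :
    blockProd n c j (t + 1) = yBlock n (fun i => c i (j + 1)) * blockProd n c (j + 1) t := by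
  rw [blockProd, orderedProd_succ', blockProd]
  simp only [add_assoc, add_comm 1]

/-- The parameters of a block, extended by the convention `d_0 = 1`. -/
def extendOne (d : ℕ → ℂˣ) : ℕ → ℂˣ := Function.update d 0 1

theorem extendOne_zero : extendOne d 0 = 1 := Function.update_self ..

theorem extendOne_succ (k : ℕ) : extendOne d (k + 1) = d (k + 1) :=
  Function.update_of_ne (Nat.succ_ne_zero k) ..

theorem coordBar_vecMul_orderedProd_yBold_self (hk : k < n) :
    coordBar n k ᵥ* mat (orderedProd (fun i => yBold n i (d i)) k) =
      (extendOne d k : ℂ)⁻¹ • coordBar n k := by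
  cases k with
  | zero => rw [orderedProd_zero, mat_one, vecMul_one, extendOne_zero, Units.val_one, inv_one,
      one_smul]
  | succ k =>
    have hfixed : coordBar n (k + 1) ᵥ* mat (orderedProd (fun i => yBold n i (d i)) k) =
        coordBar n (k + 1) := vecMul_orderedProd_of_fixed fun i hi hik =>
      coordBar_vecMul_yBold_of_ne hi (by omega) hk (by omega) (by omega) _
    rw [orderedProd_succ, mat_mul, ← vecMul_vecMul, hfixed, coordBar_succ_vecMul_yBold hk.le,
      extendOne_succ]

theorem coordBar_vecMul_orderedProd_yBold (hk : k < n) (hkm : k ≤ m) (hmn : m ≤ n) :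
    coordBar n k ᵥ* mat (orderedProd (fun i => yBold n i (d i)) m) =
      (extendOne d k : ℂ)⁻¹ •
        (∑ b ∈ Finset.Ico k m, (d (b + 1) : ℂ) • coordBar n b + coordBar n m) := by
  induction m, hkm using Nat.le_induction with
  | base => rw [coordBar_vecMul_orderedProd_yBold_self d hk, Finset.Ico_self, Finset.sum_empty,
      zero_add]
  | succ m hkm ih =>
    have hfixed : (∑ b ∈ Finset.Ico k m, (d (b + 1) : ℂ) • coordBar n b) ᵥ*
          mat (yBold n (m + 1) (d (m + 1))) =
        ∑ b ∈ Finset.Ico k m, (d (b + 1) : ℂ) • coordBar n b := by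
      rw [sum_vecMul]
      refine Finset.sum_congr rfl fun b hb => ?_
      rw [Finset.mem_Ico] at hb
      rw [smul_vecMul, coordBar_vecMul_yBold_of_ne (by omega) hmn (by omega) (by omega) (by omega)]
    rw [orderedProd_succ, mat_mul, ← vecMul_vecMul, ih (by omega), smul_vecMul, add_vecMul, hfixed,
      coordBar_vecMul_yBold hmn, Finset.sum_Ico_succ_top hkm, add_assoc]

theorem coordBar_succ_vecMul_yBlock (hk : k + 1 < n) :
    coordBar n (k + 1) ᵥ* mat (yBlock n d) =
      ((extendOne d k : ℂ) / d (k + 1)) • (coordBar n k ᵥ* mat (yBlock n d)) - coordBar n k := by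
  rw [yBlock, coordBar_vecMul_orderedProd_yBold d hk hk.le le_rfl,
    coordBar_vecMul_orderedProd_yBold d (k := k) (by omega) (by omega) le_rfl,
    Finset.sum_eq_sum_Ico_succ_bot (a := k) (by omega),
    smul_smul, div_mul_eq_mul_div, mul_inv_cancel₀ (Units.ne_zero _), one_div, add_assoc,
    smul_add _ (_ • _), smul_smul, inv_mul_cancel₀ (Units.ne_zero _), one_smul,
    add_sub_cancel_left, extendOne_succ]

theorem coord_succ_vecMul_yBlock (hp : p + 2 ≤ n) :
    coord n (p + 1) ᵥ* mat (yBlock n d) =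
      coord n p + ((d (p + 1) : ℂ) / d (p + 2)) • coord n (p + 1) := by
  have hfixed : coord n (p + 1) ᵥ* mat (orderedProd (fun i => yBold n i (d i)) p) =
      coord n (p + 1) := vecMul_orderedProd_of_fixed fun i hi hip =>
    coord_vecMul_yBold_of_not_isMoved hi (by omega) (by omega) _
  refine vecMul_orderedProd_eq (k := p + 2) hp ?_ fun i hi hin => ?_
  · rw [orderedProd_succ, orderedProd_succ, mat_mul, mat_mul, ← vecMul_vecMul, ← vecMul_vecMul,
      hfixed, coord_succ_vecMul_yBold (by omega) (by omega) (by omega), add_vecMul, smul_vecMul,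
      coord_vecMul_yBold (by omega) hp (by omega),
      coord_vecMul_yBold_of_not_isMoved (by omega) hp (by omega), smul_smul, ← div_eq_mul_inv,
      add_comm]
  · rw [add_vecMul, smul_vecMul, coord_vecMul_yBold_of_not_isMoved (by omega) hin (by omega),
      coord_vecMul_yBold_of_not_isMoved (by omega) hin (by omega)]

end ParameterBlocks

section Tail

variable {n r r' p k : ℕ} {ξ η : Idx n → ℂ} {M : Matrix (Idx n) (Idx n) ℂ}

/-- The covectors supported on the basis vectors in positions `r, r + 1, …`. Congruences modulo
`tail n r` express that two covectors have the same leading entries. -/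
def tail (n r : ℕ) : Submodule ℂ (Idx n → ℂ) := Submodule.span ℂ (coord n '' Set.Ici r)

theorem coord_mem_tail (h : r ≤ p) : coord n p ∈ tail n r :=
  Submodule.subset_span (Set.mem_image_of_mem _ h)

theorem coordBar_mem_tail (h : k < n) : coordBar n k ∈ tail n n := coord_mem_tail (by omega)

theorem tail_anti (h : r ≤ r') : tail n r' ≤ tail n r :=
  Submodule.span_mono (Set.image_mono (Set.Ici_subset_Ici.2 h))

theorem apply_eq_of_smodEq_tail (h : ξ ≡ η [SMOD tail n r]) {a : Idx n} (ha : pos n a < r) :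
    ξ a = η a := by
  have hker : tail n r ≤ LinearMap.ker (LinearMap.proj (R := ℂ) (φ := fun _ : Idx n => ℂ) a) :=
    Submodule.span_le.2 <| Set.image_subset_iff.2 fun p hp => if_neg (ha.trans_le hp).ne
  exact sub_eq_zero.1 (hker (SModEq.sub_mem.1 h))

theorem smodEq_tail_vecMul (hM : ∀ p, r ≤ p → coord n p ᵥ* M ∈ tail n r')
    (h : ξ ≡ η [SMOD tail n r]) : ξ ᵥ* M ≡ η ᵥ* M [SMOD tail n r'] := by
  have hmap : tail n r ≤ (tail n r').comap M.vecMulLinear :=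
    Submodule.span_le.2 <| Set.image_subset_iff.2 fun p hp => hM p hp
  rw [SModEq.sub_mem, ← sub_vecMul]
  exact hmap (SModEq.sub_mem.1 h)

end Tail

section LeadingEntries

variable {n p k t : ℕ} (d d' : ℕ → ℂˣ) (c : ℕ → ℕ → ℂˣ)

theorem coordBar_vecMul_yBlock_smodEq (hk : k < n) :
    coordBar n k ᵥ* mat (yBlock n d) ≡ (extendOne d k : ℂ)⁻¹ • coordBar n n [SMOD tail n n] := by
  rw [yBlock, coordBar_vecMul_orderedProd_yBold d hk hk.le le_rfl, SModEq.sub_mem, ← smul_sub,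
    add_sub_cancel_right]
  exact Submodule.smul_mem _ _ <| Submodule.sum_mem _ fun b hb =>
    Submodule.smul_mem _ _ (coordBar_mem_tail (Finset.mem_Ico.1 hb).2)

theorem coord_vecMul_yBlock_mem_tail {r : ℕ} (hr : r + 1 ≤ n) (hp : r + 1 ≤ p) :
    coord n p ᵥ* mat (yBlock n d) ∈ tail n r := by
  obtain ⟨q, rfl⟩ := Nat.exists_eq_add_of_le' hp
  rcases lt_or_ge (q + (r + 1)) n with hqn | hnq
  · rw [← add_assoc, coord_succ_vecMul_yBlock d (by omega)]
    exact add_mem (coord_mem_tail (by omega)) (Submodule.smul_mem _ _ (coord_mem_tail (by omega)))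
  rcases lt_or_ge (q + (r + 1)) (2 * n) with hqn | hnq'
  · have hbar : coordBar n (2 * n - 1 - (q + (r + 1))) = coord n (q + (r + 1)) := by
      rw [coordBar, show 2 * n - 1 - (2 * n - 1 - (q + (r + 1))) = q + (r + 1) by omega]
    rw [← hbar]
    exact SModEq.zero.1 <| ((coordBar_vecMul_yBlock_smodEq d (by omega)).mono
      (tail_anti (by omega))).trans <|
        SModEq.zero.2 (Submodule.smul_mem _ _ (coord_mem_tail (by omega)))
  · rw [coord_eq_zero hnq', zero_vecMul]
    exact zero_mem _

theorem sum_div_extendOne (hn : 0 < n) :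
    ∑ b ∈ Finset.Ico 0 n, (d (b + 1) : ℂ) / extendOne d' b =
      d 1 + ∑ j ∈ Finset.Icc 2 n, (d j : ℂ) / d' (j - 1) := by
  rw [Finset.sum_eq_sum_Ico_succ_bot hn, extendOne_zero, Units.val_one, div_one,
    ← Finset.Ico_add_one_right_eq_Icc, ← Finset.sum_Ico_add' _ 1 n 1]
  refine congrArg _ (Finset.sum_congr rfl fun b hb => ?_)
  obtain ⟨b, rfl⟩ := Nat.exists_eq_add_of_le' (Finset.mem_Ico.1 hb).1
  rw [extendOne_succ, Nat.add_sub_cancel]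

theorem smodEq_tail_vecMul_yBlock {ξ η : Idx n → ℂ} {r : ℕ} (hr : r + 1 ≤ n)
    (h : ξ ≡ η [SMOD tail n (r + 1)]) :
    ξ ᵥ* mat (yBlock n d) ≡ η ᵥ* mat (yBlock n d) [SMOD tail n r] :=
  smodEq_tail_vecMul (fun _ hp => coord_vecMul_yBlock_mem_tail d hr hp) h

theorem coordBar_zero_vecMul_yBlock :
    coordBar n 0 ᵥ* mat (yBlock n d) =
      ∑ b ∈ Finset.Ico 0 n, (d (b + 1) : ℂ) • coordBar n b + coordBar n n := by
  rcases n.eq_zero_or_pos with rfl | hn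
  · exact Subsingleton.elim _ _
  · rw [yBlock, coordBar_vecMul_orderedProd_yBold d hn hn.le le_rfl, extendOne_zero,
      Units.val_one, inv_one, one_smul]

theorem coordBar_zero_vecMul_yBlock_smodEq :
    coordBar (p + 1) 0 ᵥ* mat (yBlock (p + 1) d) ≡
      coord (p + 1) p + (d (p + 1) : ℂ) • coord (p + 1) (p + 1) [SMOD tail (p + 1) (p + 2)] := by
  have hlast : coordBar (p + 1) p = coord (p + 1) (p + 1) := by
    rw [coordBar, show 2 * (p + 1) - 1 - p = p + 1 by omega]
  rw [coordBar_zero_vecMul_yBlock, Finset.sum_Ico_succ_top p.zero_le, coordBar_self rfl, hlast,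
    SModEq.sub_mem, show ∀ a b e : Idx (p + 1) → ℂ, a + b + e - (e + b) = a by intros; abel]
  refine Submodule.sum_mem _ fun b hb => Submodule.smul_mem _ _ (coord_mem_tail ?_)
  have := (Finset.mem_Ico.1 hb).2
  omega

theorem coordBar_zero_vecMul_yBlock_mul_yBlock (hp : p + 2 = n) :
    coordBar n 0 ᵥ* mat (yBlock n d * yBlock n d') ≡
      coord n p + (d 1 + ∑ j ∈ Finset.Icc 2 n, (d j : ℂ) / d' (j - 1)
        + (d' (p + 1) : ℂ) / d' (p + 2)) • coord n (p + 1) [SMOD tail n (p + 2)] := by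
  have hself : coordBar n n = coord n (p + 1) := coordBar_self hp
  have hsum : (∑ b ∈ Finset.Ico 0 n, (d (b + 1) : ℂ) • coordBar n b) ᵥ* mat (yBlock n d') ≡
      (∑ b ∈ Finset.Ico 0 n, (d (b + 1) : ℂ) / extendOne d' b) • coordBar n n
        [SMOD tail n n] := by
    simp only [sum_vecMul, smul_vecMul, Finset.sum_smul, div_eq_mul_inv, mul_smul]
    exact SModEq.sum fun b hb =>
      (coordBar_vecMul_yBlock_smodEq d' (Finset.mem_Ico.1 hb).2).smul _
  rw [mat_mul, ← vecMul_vecMul, coordBar_zero_vecMul_yBlock, add_vecMul,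
    ← sum_div_extendOne d d' (by omega), add_smul, add_left_comm, hself,
    coord_succ_vecMul_yBlock d' hp.le, ← hself, hp]
  exact hsum.add SModEq.rfl

theorem smodEq_vecMul_yBlock {ξ : Idx n → ℂ} {s : ℂ} (hp : p + 3 ≤ n)
    (h : ξ ≡ coord n (p + 1) + s • coord n (p + 2) [SMOD tail n (p + 3)]) :
    ξ ᵥ* mat (yBlock n d) ≡
      coord n p + (s + (d (p + 1) : ℂ) / d (p + 2)) • coord n (p + 1) [SMOD tail n (p + 2)] := by
  refine (smodEq_tail_vecMul_yBlock d hp h).trans ?_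
  rw [add_vecMul, smul_vecMul, coord_succ_vecMul_yBlock d (by omega),
    coord_succ_vecMul_yBlock d hp, SModEq.sub_mem]
  convert Submodule.smul_mem (tail n (p + 2)) (s * (d (p + 2) / d (p + 3)))
    (coord_mem_tail (le_refl (p + 2))) using 1
  module

theorem blockProd_succ_right (j t : ℕ) :
    blockProd n c j (t + 1) = blockProd n c j t * yBlock n fun i => c i (j + (t + 1)) :=
  orderedProd_succ _ _

theorem coordBar_zero_vecMul_blockProd (j : ℕ) (hp : p + 2 + t = n) :
    coordBar n 0 ᵥ* mat (blockProd n c j (t + 2)) ≡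
      coord n p + (c 1 (j + 1) + ∑ i ∈ Finset.Icc 2 n, (c i (j + 1) : ℂ) / c (i - 1) (j + 2)
        + ∑ i ∈ Finset.Icc 1 (t + 1), (c (n - i) (j + 1 + i) : ℂ) / c (n - i + 1) (j + 1 + i)) •
          coord n (p + 1) [SMOD tail n (p + 2)] := by
  induction t generalizing p with
  | zero =>
    obtain rfl : p + 2 = n := hp
    rw [blockProd_succ, blockProd_succ, blockProd, orderedProd_zero, mul_one, zero_add,
      Finset.Icc_self, Finset.sum_singleton]
    exact coordBar_zero_vecMul_yBlock_mul_yBlock _ _ rfl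
  | succ t ih =>
    rw [blockProd_succ_right, mat_mul, ← vecMul_vecMul, Finset.sum_Icc_succ_top (by omega),
      ← add_assoc (_ + _) (Finset.sum _ _), show n - (t + 1 + 1) = p + 1 by omega,
      show j + 1 + (t + 1 + 1) = j + (t + 3) by omega]
    exact smodEq_vecMul_yBlock _ (by omega) (ih (by omega))

end LeadingEntries

section RowReduction

variable {R : Type*} [CommRing R] {m : ℕ} {σ : ℕ → ℕ → Fin (m + 1) → R} {a : ℕ → ℕ → R}

theorem det_of_sub_min_eq_succ (hσ : ∀ i j, i + j < m → σ (i + 1) j = σ i (j + 1) + a i j • σ i j)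
    (j : ℕ) :
    (of fun i : Fin (m + 1) => σ (i - j) (min i j)).det =
      (of fun i : Fin (m + 1) => σ (i - (j + 1)) (min i (j + 1))).det := by
  refine det_eq_of_forall_row_eq_smul_add_pred (fun i => if j ≤ i then a (i - j) j else 0)
    (fun _ => by simp) fun i b => ?_
  simp only [of_apply, Fin.val_succ, Fin.val_castSucc]
  split_ifs with hj
  · obtain ⟨d, hd⟩ := Nat.exists_eq_add_of_le' hj
    rw [hd, show d + j + 1 - j = d + 1 by omega, show min (d + j + 1) j = j by omega,
      show d + j + 1 - (j + 1) = d by omega, show min (d + j + 1) (j + 1) = j + 1 by omega,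
      Nat.add_sub_cancel, show min (d + j) j = j by omega, hσ d j (by omega)]
    simp
  · rw [show (i : ℕ) + 1 - j = i + 1 - (j + 1) by omega,
      show min ((i : ℕ) + 1) j = min ((i : ℕ) + 1) (j + 1) by omega]
    simp

theorem det_of_fst_eq_det_of_snd
    (hσ : ∀ i j, i + j < m → σ (i + 1) j = σ i (j + 1) + a i j • σ i j) :
    (of fun i : Fin (m + 1) => σ i 0).det = (of fun i : Fin (m + 1) => σ 0 i).det := by
  -- Row `i` of the `j`-th matrix has undergone `min i j` of its `i` reduction steps.
  have hdet : ∀ j, (of fun i : Fin (m + 1) => σ i 0).det =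
      (of fun i : Fin (m + 1) => σ (i - j) (min i j)).det := fun j => by
    induction j with
    | zero => simp only [Nat.sub_zero, Nat.min_zero]
    | succ j ih => rw [ih, det_of_sub_min_eq_succ hσ]
  rw [hdet m]
  refine congrArg det (congrArg of (funext fun i => ?_))
  rw [Nat.sub_eq_zero_of_le i.is_le, Nat.min_eq_left i.is_le]

end RowReduction

section Evaluation

variable {n m : ℕ} (c : ℕ → ℕ → ℂˣ)

theorem smodEq_tail_vecMul_sBar {i r : ℕ} (hi : 1 ≤ i) (hin : i ≤ n) (hri : r ≠ i)
    (hri' : r + i ≠ 2 * n) {ξ η : Idx n → ℂ} (h : ξ ≡ η [SMOD tail n r]) :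
    ξ ᵥ* mat (sBar n i) ≡ η ᵥ* mat (sBar n i) [SMOD tail n r] := by
  refine smodEq_tail_vecMul (fun p hp => ?_) h
  rcases isStep_or_isStep_pred_or_not_isMoved hi hin p with hs | ⟨q, rfl, hs⟩ | hs
  · rw [coord_vecMul_sBar hi hin hs]
    exact neg_mem (coord_mem_tail (by omega))
  · rw [coord_succ_vecMul_sBar hi hin hs]
    exact coord_mem_tail (by omega)
  · rw [coord_vecMul_sBar_of_not_isMoved hi hin hs]
    exact coord_mem_tail hp

theorem smodEq_coord_of_smodEq {p : ℕ} {ξ : Idx n → ℂ} {s : ℂ}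
    (h : ξ ≡ coord n p + s • coord n (p + 1) [SMOD tail n (p + 2)]) :
    ξ ≡ coord n p [SMOD tail n (p + 1)] := by
  refine (h.mono (tail_anti (by omega))).trans ?_
  rw [SModEq.sub_mem, add_sub_cancel_left]
  exact Submodule.smul_mem _ _ (coord_mem_tail le_rfl)

theorem coordBar_zero_vecMul_lastBlock (h : m + 1 = n) :
    coordBar n 0 ᵥ* mat (blockProd n c m (n - m)) ≡
      coord n m + (c n n : ℂ) • coord n (m + 1) [SMOD tail n (m + 2)] := by
  subst h
  rw [Nat.add_sub_cancel_left, blockProd_succ, blockProd, orderedProd_zero, mul_one]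
  exact coordBar_zero_vecMul_yBlock_smodEq _

theorem coordBar_zero_vecMul_blockProd_smodEq_coord {j : ℕ} (hj : j < n) :
    coordBar n 0 ᵥ* mat (blockProd n c j (n - j)) ≡ coord n j [SMOD tail n (j + 1)] := by
  rcases Nat.eq_or_lt_of_le hj with h | h
  · exact smodEq_coord_of_smodEq (coordBar_zero_vecMul_lastBlock c h)
  · obtain ⟨t, rfl⟩ := Nat.exists_eq_add_of_le h
    rw [show j.succ + 1 + t - j = t + 2 by omega]
    exact smodEq_coord_of_smodEq (coordBar_zero_vecMul_blockProd c j rfl)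

theorem coordBar_succ_vecMul_blockProd {i : ℕ} (hi : i + 1 < n) (j t : ℕ) :
    coordBar n (i + 1) ᵥ* mat (blockProd n c j (t + 1)) =
      ((extendOne (fun i => c i (j + 1)) i : ℂ) / c (i + 1) (j + 1)) •
        (coordBar n i ᵥ* mat (blockProd n c j (t + 1))) -
          coordBar n i ᵥ* mat (blockProd n c (j + 1) t) := by
  rw [blockProd_succ, mat_mul, ← vecMul_vecMul, coordBar_succ_vecMul_yBlock _ hi, sub_vecMul,
    smul_vecMul, vecMul_vecMul]

theorem leadingMinor_inv_wBar_mul_blockProd_mul (hm : m + 1 ≤ n) (h : G n) :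
    leadingMinor hm ((wBar n (longWord n))⁻¹ * blockProd n c 0 n * h) =
      (of fun i b : Fin (m + 1) =>
        (coordBar n 0 ᵥ* mat (blockProd n c i (n - i) * h)) (leadingIdx hm b)).det := by
  let row (i j : ℕ) : Idx n → ℂ :=
    (-1 : ℂ) ^ i • (coordBar n i ᵥ* mat (blockProd n c j (n - j) * h))
  have hstart (i : Fin (m + 1)) :
      mat ((wBar n (longWord n))⁻¹ * blockProd n c 0 n * h) (leadingIdx hm i) = row i 0 := by
    refine (coord_pos_vecMul _ _).symm.trans ?_
    rw [pos_leadingIdx, mul_assoc, mat_mul, ← vecMul_vecMul,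
      coord_vecMul_inv_wBar_longWord (by omega), smul_vecMul]
    rfl
  have hstep (i j : ℕ) (hij : i + j < m) : row (i + 1) j = row i (j + 1) +
      (-((extendOne (fun i => c i (j + 1)) i : ℂ) / c (i + 1) (j + 1))) • row i j := by
    obtain ⟨t, rfl⟩ := Nat.exists_eq_add_of_lt (show j < n by omega)
    simp only [row, show j + t + 1 - j = t + 1 by omega, show j + t + 1 - (j + 1) = t by omega,
      mat_mul, ← vecMul_vecMul]
    rw [coordBar_succ_vecMul_blockProd c (by omega), sub_vecMul, smul_vecMul]
    module
  have hdet := det_of_fst_eq_det_of_snd (σ := fun i j b => row i j (leadingIdx hm b))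
    fun i j hij => funext fun b => congrFun (hstep i j hij) (leadingIdx hm b)
  simp only [← hstart, row, pow_zero, one_smul] at hdet
  exact hdet

theorem det_of_smodEq_smul_coord {k : ℕ} (hk : k ≤ n) {ξ : Fin k → Idx n → ℂ} {s : Fin k → ℂ}
    (hξ : ∀ i : Fin k, ξ i ≡ s i • coord n i [SMOD tail n (i + 1)]) :
    (of fun i b => ξ i (leadingIdx hk b)).det = ∏ i, s i := by
  have hentry (i b : Fin k) (hb : b ≤ i) :
      ξ i (leadingIdx hk b) = (s i • coord n i) (leadingIdx hk b) :=
    apply_eq_of_smodEq_tail (hξ i) (Nat.lt_succ_of_le hb)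
  have htri : (of fun i b => ξ i (leadingIdx hk b)).IsUpperTriangular := fun i b (hb : b < i) => by
    rw [of_apply, hentry i b hb.le, Pi.smul_apply, coord, pos_leadingIdx,
      if_neg (Fin.val_ne_of_ne hb.ne), smul_zero]
  rw [det_of_isUpperTriangular htri]
  refine Finset.prod_congr rfl fun i _ => ?_
  rw [of_apply, hentry i i le_rfl, Pi.smul_apply, coord, pos_leadingIdx, if_pos rfl, smul_eq_mul,
    mul_one]

theorem coordBar_zero_vecMul_blockProd_mul_sBar_of_lt (hm : m + 1 ≤ n) {j : ℕ} (hj : j < m) :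
    coordBar n 0 ᵥ* mat (blockProd n c j (n - j) * sBar n (m + 1)) ≡
      coord n j [SMOD tail n (j + 1)] := by
  rw [mat_mul, ← vecMul_vecMul, ← coord_vecMul_sBar_of_not_isMoved (i := m + 1) (by omega) hm
    (by omega : ¬ IsMoved n (m + 1) j)]
  exact smodEq_tail_vecMul_sBar (by omega) hm (by omega) (by omega)
    (coordBar_zero_vecMul_blockProd_smodEq_coord c (hj.trans hm))

theorem smodEq_vecMul_sBar (hm : m + 1 ≤ n) {ξ : Idx n → ℂ} {s : ℂ}
    (h : ξ ≡ coord n m + s • coord n (m + 1) [SMOD tail n (m + 2)]) :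
    ξ ᵥ* mat (sBar n (m + 1)) ≡ s • coord n m [SMOD tail n (m + 1)] := by
  refine ((smodEq_tail_vecMul_sBar (by omega) hm (by omega) (by omega) h).mono
    (tail_anti (by omega))).trans ?_
  rw [add_vecMul, smul_vecMul, coord_vecMul_sBar (by omega) hm (Or.inl rfl),
    coord_succ_vecMul_sBar (by omega) hm (Or.inl rfl), SModEq.sub_mem, add_sub_cancel_right]
  exact neg_mem (coord_mem_tail le_rfl)

theorem leadingMinor_eq_of_smodEq (hm : m + 1 ≤ n) {s : ℂ}
    (hs : coordBar n 0 ᵥ* mat (blockProd n c m (n - m)) ≡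
      coord n m + s • coord n (m + 1) [SMOD tail n (m + 2)]) :
    leadingMinor hm ((wBar n (longWord n))⁻¹ * blockProd n c 0 n * sBar n (m + 1)) = s := by
  rw [leadingMinor_inv_wBar_mul_blockProd_mul, det_of_smodEq_smul_coord hm
    (s := fun i => if i = Fin.last m then s else 1), Fintype.prod_ite_eq']
  intro i
  rcases eq_or_ne i (Fin.last m) with rfl | hi
  · rw [if_pos rfl, mat_mul, ← vecMul_vecMul]
    exact smodEq_vecMul_sBar hm hs
  · rw [if_neg hi, one_smul]
    exact coordBar_zero_vecMul_blockProd_mul_sBar_of_lt c hm (Fin.val_lt_last hi)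

theorem principalMinor_eq_leadingMinor {k : ℕ} (hk : k ≤ n) {g : G n}
    (hg : g ∈ elementarySubgroup n) : principalMinor n k g = leadingMinor hk g :=
  (exists_principalMinor n k).choose_spec.eqOn_elementarySubgroup
    (isPrincipalMinor_leadingMinor hk) hg

theorem inv_wBar_mul_blockProd_mul_sBar_mem_elementarySubgroup {k : ℕ} (hk : 1 ≤ k) (hkn : k ≤ n) :
    (wBar n (longWord n))⁻¹ * blockProd n c 0 n * sBar n k ∈ elementarySubgroup n := by
  have hw : wBar n (longWord n) ∈ elementarySubgroup n := by
    rw [wBar_longWord]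
    exact pow_mem (orderedProd_mem _ fun j hj hjn => sBar_mem_elementarySubgroup hj hjn) n
  have hΘ : blockProd n c 0 n ∈ elementarySubgroup n :=
    orderedProd_mem _ fun _ _ _ => orderedProd_mem _ fun j hj hjn =>
      yBold_mem_elementarySubgroup hj hjn _
  exact mul_mem (mul_mem (inv_mem hw) hΘ) (sBar_mem_elementarySubgroup hk hkn)

theorem genMinor_longWord_Theta (hm : m + 1 ≤ n) {s : ℂ}
    (hs : coordBar n 0 ᵥ* mat (blockProd n c m (n - m)) ≡
      coord n m + s • coord n (m + 1) [SMOD tail n (m + 2)]) :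
    genMinor n (m + 1) (longWord n) [m + 1] (Theta n (longWord n) (params n c)) = s := by
  have hsimple : wBar n [m + 1] = sBar n (m + 1) := mul_one _
  rw [genMinor, hsimple, Theta_longWord, principalMinor_eq_leadingMinor hm
    (inv_wBar_mul_blockProd_mul_sBar_mem_elementarySubgroup c (by omega) hm),
    leadingMinor_eq_of_smodEq c hm hs]

end Evaluation

end TypeC


theorem mainTheorem1 (n : ℕ) (c : ℕ → ℕ → ℂˣ) :
    (∀ k : ℕ, 1 ≤ k → k < n →
      TypeC.genMinor n k (TypeC.longWord n) [k]
          (TypeC.Theta n (TypeC.longWord n) (TypeC.params n c)) =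
        (c 1 k : ℂ)
          + ∑ j ∈ Finset.Icc 2 n, (c j k : ℂ) / (c (j - 1) (k + 1) : ℂ)
          + ∑ j ∈ Finset.Icc 1 (n - k), (c (n - j) (k + j) : ℂ) / (c (n - j + 1) (k + j) : ℂ)) ∧
    (1 ≤ n →
      TypeC.genMinor n n (TypeC.longWord n) [n]
          (TypeC.Theta n (TypeC.longWord n) (TypeC.params n c)) = (c n n : ℂ)) := by
  refine ⟨fun k hk hkn => ?_, fun hn => ?_⟩
  · obtain ⟨m, rfl⟩ := Nat.exists_eq_add_of_le' hk
    obtain ⟨t, rfl⟩ := Nat.exists_eq_add_of_le hkn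
    refine TypeC.genMinor_longWord_Theta c (by omega) ?_
    rw [show m + 1 + 1 + t - m = t + 2 by omega, show m + 1 + 1 + t - (m + 1) = t + 1 by omega]
    exact TypeC.coordBar_zero_vecMul_blockProd c m rfl
  · obtain ⟨m, rfl⟩ := Nat.exists_eq_add_of_le' hn
    exact TypeC.genMinor_longWord_Theta c le_rfl (TypeC.coordBar_zero_vecMul_lastBlock c rfl)
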